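/- Let $G$ be a Lie group and $n\ge 1$. All manifolds and maps are $C^\infty$. Let $SO(n)\subset SO(n+1)$, $A\mapsto \mathrm{diag}(A,1)$, act on $S^n\subset\mathbf R^{n+1}$ by orthogonal transformations fixing the poles $(0,\dots,0,\pm1)$. An $(n,G)$-bundle is a smooth principal $G$-bundle $p\colon E\to S^n$ with a smooth left action of $SO(n)$ on $E$ that commutes with the right action of $G$ and makes $p$ equivariant; $\mathcal E(n,G)$ is the set of their isomorphism classes (diffeomorphisms of total spaces over $\mathrm{id}_{S^n}$ that are $SO(n)$- and $G$-equivariant). Let $\mathcal R(n,G)$ be the set of smooth homomorphisms $SO(n)\to G$ modulo conjugation by elements of $G$. For an $(n,G)$-bundle $\xi$ choose $a,b\in E$ with $p(a)=(0,\dots,0,-1)$ and $p(b)=(0,\dots,0,1)$; the formulae $A\cdot a=a\cdot\alpha(A)$ and $A\cdot b=b\cdot\beta(A)$ define smooth homomorphisms $\alpha,\beta\colon SO(n)\to G$, and $J(\xi)=([\alpha],[\beta])$ defines a map $J\colon\mathcal E(n,G)\to\mathcal R(n,G)\times\mathcal R(n,G)$. Let $\delta\colon SO(n)\to SO(n)$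 be the conjugation by $\mathrm{diag}(1,\dots,1,-1)$. Say that $\xi\in\mathcal E(n,G)$ comes from an $SO(n+1)$-equivariant bundle if it is the class of the restriction to $SO(n)$ of a smooth $SO(n+1)$-equivariant principal $G$-bundle over $S^n$ (for the natural action of $SO(n+1)$ on $S^n$). (i) If $\xi\in\mathcal E(n,G)$ comes from an $SO(n+1)$-equivariant bundle, then $J(\xi)=([\alpha],[\alpha\circ\delta])$ for some smooth homomorphism $\alpha\colon SO(n)\to G$. (ii) For each smooth homomorphism $\alpha\colon SO(n)\to G$ there is a unique $\xi\in\mathcal E(n,G)$ which comes from an $SO(n+1)$-equivariant bundle and satisfies $J(\xi)=([\alpha],[\alpha\circ\delta])$. It is obtained by the Borel construction from $SO(n+1)\to S^n$ (the last column) and $\alpha\circ\delta$: the quotient space $SO(n+1)\times G/\{(BA,g)\sim(B,\alpha(\delta(A))g),\ A\in SO(n)\}$, with projection $[B,g]\mapsto$ last column of $B$, right action $[B,g]\cdot g'=[B,gg']$ and left action $C\cdot[B,g]=[CB,g]$, has a smooth structure for which the quotient map is smooth and which makes it a smooth $SO(n+1)$-equivariant principal $G$-bundle whose restriction to $SO(n)$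 has this value of $J$. -/

import Mathlib

open scoped Manifold ContDiff Matrix

noncomputable section

/-! ### The Lie group `SO(n)` -/

/-- The special orthogonal group `SO(n)` of real `n × n` matrices. -/
abbrev SO (n : ℕ) : Type := Matrix.specialOrthogonalGroup (Fin n) ℝ

namespace SO

variable {n : ℕ}

theorem mul_transpose (A : SO n) : A.1 * A.1ᵀ = 1 :=
  (Matrix.mem_orthogonalGroup_iff (Fin n) ℝ).1 A.2.1

theorem transpose_mul (A : SO n) : A.1ᵀ * A.1 = 1 :=
  (Matrix.mem_orthogonalGroup_iff' (Fin n) ℝ).1 A.2.1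

theorem det_eq (A : SO n) : A.1.det = 1 := A.2.2

theorem coe_mul (A B : SO n) : (A * B).1 = A.1 * B.1 := rfl

theorem coe_one : (1 : SO n).1 = 1 := rfl

theorem coe_inv (A : SO n) : (A⁻¹).1 = A.1ᵀ := rfl

/-- Constructor from the defining equations. -/
def mk (A : Matrix (Fin n) (Fin n) ℝ) (h : A * Aᵀ = 1) (hd : A.det = 1) : SO n :=
  ⟨A, (Matrix.mem_orthogonalGroup_iff (Fin n) ℝ).2 h, hd⟩

instance : IsTopologicalGroup (SO n) where
  continuous_mul := by
    refine Continuous.subtype_mk ?_ _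
    exact (continuous_subtype_val.comp continuous_fst).matrix_mul
      (continuous_subtype_val.comp continuous_snd)
  continuous_inv := by
    refine Continuous.subtype_mk ?_ _
    exact continuous_subtype_val.matrix_transpose

end SO

/-- The space `𝔰𝔬(n)` of skew-symmetric matrices, with the sup norm of the entries; it is the model
space of the manifold `SO(n)`. -/
abbrev skewMatrices (n : ℕ) : Submodule ℝ (Fin n → Fin n → ℝ) where
  carrier := {X | ∀ i j, X i j = - X j i}
  add_mem' := by
    intro X Y hX hY i j
    simp only [Pi.add_apply]
    rw [hX i j, hY i j]; ring
  zero_mem' := by intro i j; simp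
  smul_mem' := by
    intro c X hX i j
    simp only [Pi.smul_apply, smul_eq_mul]
    rw [hX i j]; ring

/-- The skew-symmetric part of a matrix. -/
def skewPart (n : ℕ) : (Fin n → Fin n → ℝ) →ₗ[ℝ] skewMatrices n where
  toFun X := ⟨fun i j => (X i j - X j i) / 2, fun i j => by ring⟩
  map_add' X Y := by ext i j; simp only [Pi.add_apply, Submodule.coe_add]; ring
  map_smul' c X := by
    ext i j; simp only [Pi.smul_apply, smul_eq_mul, RingHom.id_apply, Submodule.coe_smul]; ring

theorem skewPart_coe {n : ℕ} (X : skewMatrices n) : skewPart n X.1 = X := by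
  ext i j
  change (X.1 i j - X.1 j i) / 2 = X.1 i j
  have := X.2 j i
  linarith

/-- The Cayley transform `M ↦ (1 - M)(1 + M)⁻¹`. -/
def cayley {n : ℕ} (M : Matrix (Fin n) (Fin n) ℝ) : Matrix (Fin n) (Fin n) ℝ :=
  (1 - M) * (1 + M)⁻¹

section CayleyAlgebra

variable {n : ℕ}

theorem det_one_add_skew_ne_zero (X : Matrix (Fin n) (Fin n) ℝ) (hX : Xᵀ = -X) :
    (1 + X).det ≠ 0 := by
  intro h
  obtain ⟨v, hv, hv'⟩ := Matrix.exists_mulVec_eq_zero_iff.2 h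
  rw [Matrix.add_mulVec, Matrix.one_mulVec] at hv'
  have h1 : v ⬝ᵥ (X *ᵥ v) = 0 := by
    have : v ⬝ᵥ (X *ᵥ v) = - (v ⬝ᵥ (X *ᵥ v)) := by
      conv_lhs => rw [Matrix.dotProduct_mulVec, ← Matrix.mulVec_transpose, hX, Matrix.neg_mulVec,
        neg_dotProduct, dotProduct_comm]
    linarith
  have h2 : v ⬝ᵥ v = 0 := by
    have := congrArg (fun w => v ⬝ᵥ w) hv'
    simpa [dotProduct_add, h1] using this
  exact hv (dotProduct_self_eq_zero.1 h2)

theorem one_add_cayley (M : Matrix (Fin n) (Fin n) ℝ) (h : (1 + M).det ≠ 0) :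
    1 + cayley M = (2 : ℝ) • (1 + M)⁻¹ := by
  have hu : IsUnit (1 + M).det := isUnit_iff_ne_zero.2 h
  have e : (1 : Matrix (Fin n) (Fin n) ℝ) = (1 + M) * (1 + M)⁻¹ := (Matrix.mul_nonsing_inv _ hu).symm
  unfold cayley
  nth_rewrite 1 [e]
  rw [← add_mul]
  have : (1 + M) + (1 - M) = (2 : ℝ) • (1 : Matrix (Fin n) (Fin n) ℝ) := by
    rw [two_smul]; abel
  rw [this, smul_mul_assoc, one_mul]

theorem one_sub_cayley (M : Matrix (Fin n) (Fin n) ℝ) (h : (1 + M).det ≠ 0) :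
    1 - cayley M = (2 : ℝ) • (M * (1 + M)⁻¹) := by
  have hu : IsUnit (1 + M).det := isUnit_iff_ne_zero.2 h
  have e : (1 : Matrix (Fin n) (Fin n) ℝ) = (1 + M) * (1 + M)⁻¹ := (Matrix.mul_nonsing_inv _ hu).symm
  unfold cayley
  nth_rewrite 1 [e]
  rw [← sub_mul]
  have : (1 + M) - (1 - M) = (2 : ℝ) • M := by
    rw [two_smul]; abel
  rw [this, smul_mul_assoc]

theorem det_one_add_cayley_ne_zero (M : Matrix (Fin n) (Fin n) ℝ) (h : (1 + M).det ≠ 0) :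
    (1 + cayley M).det ≠ 0 := by
  rw [one_add_cayley M h, Matrix.det_smul, Matrix.det_nonsing_inv]
  exact mul_ne_zero (pow_ne_zero _ two_ne_zero) (by simpa using h)

theorem cayley_cayley (M : Matrix (Fin n) (Fin n) ℝ) (h : (1 + M).det ≠ 0) :
    cayley (cayley M) = M := by
  have hu : IsUnit (1 + M).det := isUnit_iff_ne_zero.2 h
  have hu' : IsUnit (1 + cayley M).det := isUnit_iff_ne_zero.2 (det_one_add_cayley_ne_zero M h)
  have key : 1 - cayley M = M * (1 + cayley M) := by
    rw [one_sub_cayley M h, one_add_cayley M h, mul_smul_comm]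
  rw [show cayley (cayley M) = (1 - cayley M) * (1 + cayley M)⁻¹ from rfl, key, mul_assoc,
    Matrix.mul_nonsing_inv _ hu', mul_one]

theorem cayley_orthogonal_transpose (A : Matrix (Fin n) (Fin n) ℝ) (hA : A * Aᵀ = 1)
    (h : (1 + A).det ≠ 0) : (cayley A)ᵀ = - cayley A := by
  have hA' : Aᵀ * A = 1 := mul_eq_one_comm.1 hA
  have hu : IsUnit (1 + A).det := isUnit_iff_ne_zero.2 h
  have hu' : IsUnit (1 + Aᵀ).det := by
    rw [show (1 + Aᵀ) = (1 + A)ᵀ by simp, Matrix.det_transpose]; exact hu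
  have e : (1 + Aᵀ) * ((cayley A)ᵀ * (1 + A)) = (1 + Aᵀ) * (- cayley A * (1 + A)) := by
    have l : (1 + Aᵀ) * (cayley A)ᵀ = 1 - Aᵀ := by
      unfold cayley
      rw [Matrix.transpose_mul, Matrix.transpose_nonsing_inv, Matrix.transpose_add,
        Matrix.transpose_sub, Matrix.transpose_one, ← mul_assoc, Matrix.mul_nonsing_inv _ hu',
        one_mul]
    have r : cayley A * (1 + A) = 1 - A := by
      unfold cayley
      rw [mul_assoc, Matrix.nonsing_inv_mul _ hu, mul_one]
    rw [← mul_assoc, l, neg_mul, r]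
    simp only [sub_mul, mul_add, mul_sub, add_mul, mul_neg, one_mul, mul_one, hA']
    abel
  have e2 := (Matrix.isUnit_iff_isUnit_det _).2 hu' |>.mul_left_cancel e
  exact (Matrix.isUnit_iff_isUnit_det _).2 hu |>.mul_right_cancel e2

theorem cayley_skew_orthogonal (X : Matrix (Fin n) (Fin n) ℝ) (hX : Xᵀ = -X) :
    cayley X * (cayley X)ᵀ = 1 := by
  have h := det_one_add_skew_ne_zero X hX
  have hu : IsUnit (1 + X).det := isUnit_iff_ne_zero.2 h
  have hu' : IsUnit (1 - X).det := by
    rw [show (1 - X) = (1 + X)ᵀ by simp [hX, sub_eq_add_neg], Matrix.det_transpose]; exact hu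
  have c : (1 - X) * (1 + X) = (1 + X) * (1 - X) := by noncomm_ring
  have c' : (1 + X)⁻¹ * (1 - X)⁻¹ = (1 - X)⁻¹ * (1 + X)⁻¹ := by
    rw [← Matrix.mul_inv_rev, ← Matrix.mul_inv_rev, c]
  unfold cayley
  rw [Matrix.transpose_mul, Matrix.transpose_nonsing_inv, Matrix.transpose_add,
    Matrix.transpose_sub, Matrix.transpose_one, hX, sub_neg_eq_add, ← sub_eq_add_neg,
    mul_assoc, ← mul_assoc (1 + X)⁻¹, c', mul_assoc, Matrix.nonsing_inv_mul _ hu, mul_one,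
    Matrix.mul_nonsing_inv _ hu']

theorem det_cayley_skew (X : Matrix (Fin n) (Fin n) ℝ) (hX : Xᵀ = -X) :
    (cayley X).det = 1 := by
  have h := det_one_add_skew_ne_zero X hX
  unfold cayley
  rw [Matrix.det_mul, Matrix.det_nonsing_inv, Ring.inverse_eq_inv',
    show (1 - X) = (1 + X)ᵀ by simp [hX, sub_eq_add_neg], Matrix.det_transpose,
    mul_inv_cancel₀ h]

theorem transpose_skew (X : skewMatrices n) :
    (Matrix.of X.1)ᵀ = - Matrix.of X.1 := by
  ext i j
  exact X.2 j i

theorem continuousOn_cayley :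
    ContinuousOn (cayley (n := n)) {M | (1 + M).det ≠ 0} := by
  intro M hM
  apply ContinuousAt.continuousWithinAt
  unfold cayley
  refine ContinuousAt.mul (by fun_prop) ?_
  have : ContinuousAt (fun M : Matrix (Fin n) (Fin n) ℝ => M⁻¹) (1 + M) := by
    apply continuousAt_matrix_inv
    rw [Ring.inverse_eq_inv']
    exact continuousAt_inv₀ hM
  exact ContinuousAt.comp (g := fun M : Matrix (Fin n) (Fin n) ℝ => M⁻¹)
    (f := fun M => 1 + M) this (by fun_prop)

end CayleyAlgebra

/-- The Cayley chart of `SO(n)` around the identity. -/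
def cayleyChart (n : ℕ) : OpenPartialHomeomorph (SO n) (skewMatrices n) where
  toFun A := skewPart n (cayley A.1)
  invFun X := SO.mk (cayley (Matrix.of X.1)) (cayley_skew_orthogonal _ (transpose_skew X))
    (det_cayley_skew _ (transpose_skew X))
  source := {A | (1 + A.1).det ≠ 0}
  target := Set.univ
  map_source' _ _ := Set.mem_univ _
  map_target' X _ :=
    det_one_add_cayley_ne_zero _ (det_one_add_skew_ne_zero _ (transpose_skew X))
  left_inv' A hA := by
    apply Subtype.ext
    have h : Matrix.of (skewPart n (cayley A.1)).1 = cayley A.1 := by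
      have ht := cayley_orthogonal_transpose A.1 A.mul_transpose hA
      ext i j
      have hij : cayley A.1 j i = - cayley A.1 i j := congrFun (congrFun ht i) j
      change (cayley A.1 i j - cayley A.1 j i) / 2 = cayley A.1 i j
      rw [hij]; ring
    change cayley (Matrix.of (skewPart n (cayley A.1)).1) = A.1
    rw [h, cayley_cayley _ hA]
  right_inv' X _ := by
    change skewPart n (cayley (cayley (Matrix.of X.1))) = X
    rw [cayley_cayley _ (det_one_add_skew_ne_zero _ (transpose_skew X))]
    exact skewPart_coe X
  open_source := by
    have : Continuous fun A : SO n => (1 + A.1).det :=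
      (continuous_const.add continuous_subtype_val).matrix_det
    exact isOpen_ne_fun this continuous_const
  open_target := isOpen_univ
  continuousOn_toFun := by
    refine (LinearMap.continuous_of_finiteDimensional (skewPart n)).comp_continuousOn ?_
    exact continuousOn_cayley.comp continuous_subtype_val.continuousOn fun A hA => hA
  continuousOn_invFun := by
    refine Continuous.continuousOn ?_
    refine Continuous.subtype_mk ?_ _
    refine continuousOn_cayley.comp_continuous (f := fun X : skewMatrices n => Matrix.of X.1)
      continuous_subtype_val fun X => ?_
    exact det_one_add_skew_ne_zero _ (transpose_skew X)

/-- The standard smooth atlas of `SO(n)`: the left translates of the Cayley chart. -/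
instance (n : ℕ) : ChartedSpace (skewMatrices n) (SO n) where
  atlas := Set.range fun A : SO n =>
    (Homeomorph.mulLeft A⁻¹).toOpenPartialHomeomorph ≫ₕ cayleyChart n
  chartAt A := (Homeomorph.mulLeft A⁻¹).toOpenPartialHomeomorph ≫ₕ cayleyChart n
  mem_chart_source A := by
    refine ⟨Set.mem_univ _, ?_⟩
    change (1 + (A⁻¹ * A).1).det ≠ 0
    rw [inv_mul_cancel, SO.coe_one, ← two_smul ℝ, Matrix.det_smul]
    simp
  chart_mem_atlas A := ⟨A, rfl⟩

/-- The model with corners of `SO(n)`. -/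
abbrev soModel (n : ℕ) : ModelWithCorners ℝ (skewMatrices n) (skewMatrices n) :=
  𝓘(ℝ, skewMatrices n)

section Smoothness

variable {E H M : Type*} [NormedAddCommGroup E] [NormedSpace ℝ E] [TopologicalSpace H]
  {I : ModelWithCorners ℝ E H} [TopologicalSpace M] [ChartedSpace H M] {n : ℕ} {x : M}

theorem contMDiffAt_matrix_det {f : M → Matrix (Fin n) (Fin n) ℝ}
    (hf : ∀ i j, ContMDiffAt I 𝓘(ℝ, ℝ) ∞ (fun y => f y i j) x) :
    ContMDiffAt I 𝓘(ℝ, ℝ) ∞ (fun y => (f y).det) x := by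
  simp only [Matrix.det_apply']
  refine ContMDiffAt.sum fun σ _ => ?_
  refine ContMDiffAt.mul contMDiffAt_const ?_
  exact contMDiffAt_finsetProd fun i _ => hf _ _

theorem contMDiffAt_matrix_mul {f g : M → Matrix (Fin n) (Fin n) ℝ}
    (hf : ∀ i j, ContMDiffAt I 𝓘(ℝ, ℝ) ∞ (fun y => f y i j) x)
    (hg : ∀ i j, ContMDiffAt I 𝓘(ℝ, ℝ) ∞ (fun y => g y i j) x) (i j : Fin n) :
    ContMDiffAt I 𝓘(ℝ, ℝ) ∞ (fun y => (f y * g y) i j) x := by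
  simp only [Matrix.mul_apply]
  exact ContMDiffAt.sum fun k _ => (hf i k).mul (hg k j)

theorem contMDiffAt_matrix_const_mul (C : Matrix (Fin n) (Fin n) ℝ)
    {g : M → Matrix (Fin n) (Fin n) ℝ}
    (hg : ∀ i j, ContMDiffAt I 𝓘(ℝ, ℝ) ∞ (fun y => g y i j) x) (i j : Fin n) :
    ContMDiffAt I 𝓘(ℝ, ℝ) ∞ (fun y => (C * g y) i j) x :=
  contMDiffAt_matrix_mul (f := fun _ => C) (fun _ _ => contMDiffAt_const) hg i j

theorem contMDiffAt_matrix_inv {f : M → Matrix (Fin n) (Fin n) ℝ}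
    (hf : ∀ i j, ContMDiffAt I 𝓘(ℝ, ℝ) ∞ (fun y => f y i j) x) (hx : (f x).det ≠ 0)
    (i j : Fin n) : ContMDiffAt I 𝓘(ℝ, ℝ) ∞ (fun y => (f y)⁻¹ i j) x := by
  simp only [Matrix.inv_def, Ring.inverse_eq_inv', Matrix.smul_apply, smul_eq_mul,
    Matrix.adjugate_apply]
  refine ContMDiffAt.mul ((contMDiffAt_matrix_det hf).inv₀ hx) ?_
  refine contMDiffAt_matrix_det fun k l => ?_
  by_cases hk : k = j
  · subst hk
    simp only [Matrix.updateRow_self]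
    exact contMDiffAt_const
  · simp only [Matrix.updateRow_ne hk]
    exact hf k l

theorem contMDiffAt_cayley {f : M → Matrix (Fin n) (Fin n) ℝ}
    (hf : ∀ i j, ContMDiffAt I 𝓘(ℝ, ℝ) ∞ (fun y => f y i j) x) (hx : (1 + f x).det ≠ 0)
    (i j : Fin n) : ContMDiffAt I 𝓘(ℝ, ℝ) ∞ (fun y => cayley (f y) i j) x := by
  unfold cayley
  refine contMDiffAt_matrix_mul (f := fun y => 1 - f y) (g := fun y => (1 + f y)⁻¹)
    (fun i j => ?_) (fun i j => ?_) i j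
  · exact contMDiffAt_const.sub (hf i j)
  · exact contMDiffAt_matrix_inv (f := fun y => 1 + f y)
      (fun i j => contMDiffAt_const.add (hf i j)) hx i j

theorem contMDiffAt_skewPart {f : M → Matrix (Fin n) (Fin n) ℝ}
    (hf : ∀ i j, ContMDiffAt I 𝓘(ℝ, ℝ) ∞ (fun y => f y i j) x) :
    ContMDiffAt I (soModel n) ∞ (fun y => skewPart n (f y)) x := by
  have h : ContMDiffAt I 𝓘(ℝ, Fin n → Fin n → ℝ) ∞ (fun y i j => f y i j) x :=
    contMDiffAt_pi_space.2 fun i => contMDiffAt_pi_space.2 fun j => hf i j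
  exact ContMDiffAt.comp (I' := 𝓘(ℝ, Fin n → Fin n → ℝ)) (g := skewPart n)
    (f := fun y i j => f y i j) x
    (LinearMap.toContinuousLinearMap (skewPart n)).contDiff.contMDiff.contMDiffAt h

theorem contMDiffAt_skewMatrices_apply (X : skewMatrices n) (i j : Fin n) :
    ContMDiffAt (soModel n) 𝓘(ℝ, ℝ) ∞ (fun Y : skewMatrices n => Y.1 i j) X := by
  have h : ContDiff ℝ ∞ (fun Y : skewMatrices n => Y.1 i j) := by
    have : ContDiff ℝ ∞ (fun Y : skewMatrices n => (Y.1 : Fin n → Fin n → ℝ)) :=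
      (skewMatrices n).subtypeL.contDiff
    exact contDiff_pi.1 (contDiff_pi.1 this i) j
  exact h.contMDiff.contMDiffAt

end Smoothness

instance (n : ℕ) : IsManifold (soModel n) ∞ (SO n) := by
  apply isManifold_of_contDiffOn
  rintro _ _ ⟨A, rfl⟩ ⟨B, rfl⟩ X ⟨hX, -⟩
  have hX' : (1 + B.1ᵀ * (A.1 * cayley (Matrix.of X.1))).det ≠ 0 := by
    have := hX.2.2
    change (1 + (B⁻¹ * ((A⁻¹)⁻¹ * (cayleyChart n).symm X)).1).det ≠ 0 at this
    rw [inv_inv] at this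
    exact this
  have key : ContMDiffAt (soModel n) (soModel n) ∞ (fun Y : skewMatrices n =>
      skewPart n (cayley (B.1ᵀ * (A.1 * cayley (Matrix.of Y.1))))) X := by
    refine contMDiffAt_skewPart fun i j => contMDiffAt_cayley
      (f := fun Y : skewMatrices n => B.1ᵀ * (A.1 * cayley (Matrix.of Y.1)))
      (fun i j => ?_) hX' i j
    refine contMDiffAt_matrix_const_mul _ (fun i j => ?_) i j
    refine contMDiffAt_matrix_const_mul _ (fun i j => ?_) i j
    exact contMDiffAt_cayley (contMDiffAt_skewMatrices_apply X)
      (det_one_add_skew_ne_zero _ (transpose_skew X)) i j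
  refine (contMDiffAt_iff_contDiffAt.1 key).contDiffWithinAt.congr_of_mem (fun Y _ => ?_)
    ⟨hX, by simp⟩
  change skewPart n (cayley (B⁻¹ * ((A⁻¹)⁻¹ * (cayleyChart n).symm Y)).1) = _
  rw [inv_inv]
  rfl

section Smoothness

variable {E H M : Type*} [NormedAddCommGroup E] [NormedSpace ℝ E] [TopologicalSpace H]
  {I : ModelWithCorners ℝ E H} [TopologicalSpace M] [ChartedSpace H M] {n : ℕ}

/-- The matrix entries are smooth functions on `SO(n)`. -/
theorem SO.contMDiff_apply (i j : Fin n) :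
    ContMDiff (soModel n) 𝓘(ℝ, ℝ) ∞ (fun A : SO n => A.1 i j) := by
  intro A
  have hc : ContMDiffAt (soModel n) (soModel n) ∞ (chartAt (skewMatrices n) A) A :=
    contMDiffAt_of_mem_maximalAtlas (IsManifold.chart_mem_maximalAtlas A)
      (mem_chart_source _ A)
  have h : ContMDiffAt (soModel n) 𝓘(ℝ, ℝ) ∞
      (fun X : skewMatrices n => (A.1 * cayley (Matrix.of X.1)) i j) (chartAt _ A A) :=
    contMDiffAt_matrix_const_mul _
      (contMDiffAt_cayley (contMDiffAt_skewMatrices_apply _)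
        (det_one_add_skew_ne_zero _ (transpose_skew _))) i j
  refine (h.comp A hc).congr_of_eventuallyEq ?_
  filter_upwards [(chartAt (skewMatrices n) A).open_source.mem_nhds (mem_chart_source _ A)]
    with B hB
  have e := (chartAt (skewMatrices n) A).left_inv hB
  have e' : (A⁻¹)⁻¹ * (cayleyChart n).symm (chartAt (skewMatrices n) A B) = B := e
  rw [inv_inv] at e'
  exact congrFun (congrFun (congrArg Subtype.val e') i) j |>.symm

/-- A map into `SO(n)` is smooth as soon as its matrix entries are. -/
theorem SO.contMDiff_of_apply {f : M → SO n}
    (hf : ∀ i j, ContMDiff I 𝓘(ℝ, ℝ) ∞ (fun y => (f y).1 i j)) :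
    ContMDiff I (soModel n) ∞ f := by
  intro x
  rw [contMDiffAt_iff_target]
  refine ⟨?_, ?_⟩
  · refine Continuous.continuousAt (continuous_induced_rng.2 ?_)
    exact continuous_pi fun i => continuous_pi fun j => (hf i j).continuous
  · change ContMDiffAt I (soModel n) ∞
      (fun y => skewPart n (cayley ((f x).1ᵀ * (f y).1))) x
    refine contMDiffAt_skewPart fun i j => contMDiffAt_cayley (fun i j => ?_) ?_ i j
    · exact contMDiffAt_matrix_const_mul _ (fun i j => hf i j x) i j
    · rw [SO.transpose_mul, ← two_smul ℝ, Matrix.det_smul]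
      simp

end Smoothness

instance (n : ℕ) : LieGroup (soModel n) ∞ (SO n) where
  contMDiff_mul := by
    refine SO.contMDiff_of_apply fun i j x => ?_
    exact contMDiffAt_matrix_mul
      (fun i j => ((SO.contMDiff_apply i j).comp contMDiff_fst).contMDiffAt)
      (fun i j => ((SO.contMDiff_apply i j).comp contMDiff_snd).contMDiffAt) i j
  contMDiff_inv := SO.contMDiff_of_apply fun i j => SO.contMDiff_apply j i

/-! ### The sphere, the inclusion `SO(n) ⊂ SO(n+1)` and the automorphism `δ` -/

/-- The unit sphere `S^n` in `ℝ^(n+1)`. -/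
abbrev Sph (n : ℕ) : Type := Metric.sphere (0 : EuclideanSpace ℝ (Fin (n + 1))) 1

/-- The action of `SO(n+1)` on `S^n` by matrix multiplication. -/
instance (n : ℕ) : MulAction (SO (n + 1)) (Sph n) where
  smul A x := ⟨WithLp.toLp 2 (A.1 *ᵥ x.1.ofLp), by
    have hx : ‖x.1‖ = 1 := by simp
    rw [mem_sphere_zero_iff_norm, ← sq_eq_sq₀ (norm_nonneg _) zero_le_one, one_pow,
      EuclideanSpace.real_norm_sq_eq]
    have hx2 : ∑ i, x.1.ofLp i ^ 2 = 1 := by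
      rw [← EuclideanSpace.real_norm_sq_eq, hx, one_pow]
    have e : (A.1 *ᵥ x.1.ofLp) ⬝ᵥ (A.1 *ᵥ x.1.ofLp) = x.1.ofLp ⬝ᵥ x.1.ofLp := by
      rw [Matrix.dotProduct_mulVec, ← Matrix.mulVec_transpose, Matrix.mulVec_mulVec,
        SO.transpose_mul, Matrix.one_mulVec]
    simp only [dotProduct, ← pow_two] at e
    exact e.trans hx2⟩
  one_smul x := by
    apply Subtype.ext
    change WithLp.toLp 2 ((1 : Matrix _ _ ℝ) *ᵥ x.1.ofLp) = x.1
    rw [Matrix.one_mulVec]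
  mul_smul A B x := by
    apply Subtype.ext
    change WithLp.toLp 2 ((A.1 * B.1) *ᵥ x.1.ofLp) = WithLp.toLp 2 (A.1 *ᵥ (B.1 *ᵥ x.1.ofLp))
    rw [Matrix.mulVec_mulVec]

theorem Sph.smul_apply {n : ℕ} (A : SO (n + 1)) (x : Sph n) (i : Fin (n + 1)) :
    (A • x).1 i = ∑ j, A.1 i j * x.1 j := rfl

/-- The north pole `(0, …, 0, 1)`. -/
def northPole (n : ℕ) : Sph n := ⟨EuclideanSpace.single (Fin.last n) 1, by simp⟩

/-- The south pole `(0, …, 0, -1)`. -/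
def southPole (n : ℕ) : Sph n := ⟨EuclideanSpace.single (Fin.last n) (-1), by simp⟩

/-- `A • northPole` is the last column of `A`. -/
theorem smul_northPole_apply {n : ℕ} (A : SO (n + 1)) (i : Fin (n + 1)) :
    (A • northPole n).1 i = A.1 i (Fin.last n) := by
  rw [Sph.smul_apply]
  simp [northPole]

/-- The block matrix `diag(A, 1)`. -/
def blockOne {n : ℕ} (A : Matrix (Fin n) (Fin n) ℝ) : Matrix (Fin (n + 1)) (Fin (n + 1)) ℝ :=
  Matrix.reindex finSumFinEquiv finSumFinEquiv (Matrix.fromBlocks A 0 0 (1 : Matrix (Fin 1) (Fin 1) ℝ))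

theorem blockOne_mul {n : ℕ} (A B : Matrix (Fin n) (Fin n) ℝ) :
    blockOne (A * B) = blockOne A * blockOne B := by
  simp [blockOne, Matrix.submatrix_mul_equiv, Matrix.fromBlocks_multiply]

theorem blockOne_one {n : ℕ} : blockOne (1 : Matrix (Fin n) (Fin n) ℝ) = 1 := by
  simp [blockOne]

theorem blockOne_transpose {n : ℕ} (A : Matrix (Fin n) (Fin n) ℝ) :
    (blockOne A)ᵀ = blockOne Aᵀ := by
  simp [blockOne, Matrix.fromBlocks_transpose]

theorem blockOne_det {n : ℕ} (A : Matrix (Fin n) (Fin n) ℝ) : (blockOne A).det = A.det := by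
  simp [blockOne]

theorem blockOne_castSucc_castSucc {n : ℕ} (A : Matrix (Fin n) (Fin n) ℝ) (i j : Fin n) :
    blockOne A i.castSucc j.castSucc = A i j := by
  have h : ∀ k : Fin n, finSumFinEquiv.symm k.castSucc = (Sum.inl k : Fin n ⊕ Fin 1) :=
    fun k => finSumFinEquiv_symm_apply_castAdd k
  simp [blockOne, h]

theorem blockOne_castSucc_last {n : ℕ} (A : Matrix (Fin n) (Fin n) ℝ) (i : Fin n) :
    blockOne A i.castSucc (Fin.last n) = 0 := by
  have h : ∀ k : Fin n, finSumFinEquiv.symm k.castSucc = (Sum.inl k : Fin n ⊕ Fin 1) :=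
    fun k => finSumFinEquiv_symm_apply_castAdd k
  have h' : finSumFinEquiv.symm (Fin.last n) = (Sum.inr 0 : Fin n ⊕ Fin 1) :=
    finSumFinEquiv_symm_last
  simp [blockOne, h, h']

theorem blockOne_last_castSucc {n : ℕ} (A : Matrix (Fin n) (Fin n) ℝ) (i : Fin n) :
    blockOne A (Fin.last n) i.castSucc = 0 := by
  rw [← Matrix.transpose_apply (blockOne A), blockOne_transpose, blockOne_castSucc_last]

theorem blockOne_last_last {n : ℕ} (A : Matrix (Fin n) (Fin n) ℝ) :
    blockOne A (Fin.last n) (Fin.last n) = 1 := by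
  have h' : finSumFinEquiv.symm (Fin.last n) = (Sum.inr 0 : Fin n ⊕ Fin 1) :=
    finSumFinEquiv_symm_last
  simp [blockOne, h']

/-- The inclusion `SO(n) ⊂ SO(n+1)`, `A ↦ diag(A, 1)`, as the subgroup fixing the poles. -/
def SO.incl (n : ℕ) : SO n →* SO (n + 1) where
  toFun A := SO.mk (blockOne A.1)
    (by rw [blockOne_transpose, ← blockOne_mul, A.mul_transpose, blockOne_one])
    (by rw [blockOne_det, A.det_eq])
  map_one' := Subtype.ext blockOne_one
  map_mul' A B := Subtype.ext (blockOne_mul A.1 B.1)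

theorem SO.contMDiff_incl (n : ℕ) :
    ContMDiff (soModel n) (soModel (n + 1)) ∞ (SO.incl n) := by
  refine SO.contMDiff_of_apply fun i j => ?_
  change ContMDiff (soModel n) 𝓘(ℝ, ℝ) ∞ (fun A : SO n => blockOne A.1 i j)
  induction i using Fin.lastCases with
  | last =>
    induction j using Fin.lastCases with
    | last => simp only [blockOne_last_last]; exact contMDiff_const
    | cast j => simp only [blockOne_last_castSucc]; exact contMDiff_const
  | cast i =>
    induction j using Fin.lastCases with
    | last => simp only [blockOne_castSucc_last]; exact contMDiff_const
    | cast j => simp only [blockOne_castSucc_castSucc]; exact SO.contMDiff_apply i j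

theorem SO.incl_smul_northPole {n : ℕ} (A : SO n) : SO.incl n A • northPole n = northPole n := by
  apply Subtype.ext
  ext i
  rw [Sph.smul_apply, Fin.sum_univ_castSucc]
  change (∑ j : Fin n, blockOne A.1 i j.castSucc * _) + blockOne A.1 i (Fin.last n) * _ = _
  induction i using Fin.lastCases with
  | last => simp [northPole, blockOne_last_last]
  | cast i => simp [northPole, blockOne_castSucc_last]

theorem SO.incl_smul_southPole {n : ℕ} (A : SO n) : SO.incl n A • southPole n = southPole n := by
  apply Subtype.ext
  ext i
  rw [Sph.smul_apply, Fin.sum_univ_castSucc]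
  change (∑ j : Fin n, blockOne A.1 i j.castSucc * _) + blockOne A.1 i (Fin.last n) * _ = _
  induction i using Fin.lastCases with
  | last => simp [southPole, blockOne_last_last]
  | cast i => simp [southPole, blockOne_castSucc_last]

/-- The diagonal `n × n` matrix `diag(1, …, 1, -1)`. -/
def lastReflection (n : ℕ) : Matrix (Fin n) (Fin n) ℝ :=
  Matrix.diagonal fun i => if i.val + 1 = n then -1 else 1

theorem lastReflection_mul_self (n : ℕ) : lastReflection n * lastReflection n = 1 := by
  rw [lastReflection, Matrix.diagonal_mul_diagonal, ← Matrix.diagonal_one]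
  congr 1
  ext i
  split_ifs <;> norm_num

theorem lastReflection_transpose (n : ℕ) : (lastReflection n)ᵀ = lastReflection n :=
  Matrix.diagonal_transpose _

/-- The automorphism `δ` of `SO(n)`: conjugation by `diag(1, …, 1, -1)` (which is its own
inverse). -/
def SO.delta (n : ℕ) : SO n →* SO n where
  toFun A := SO.mk (lastReflection n * A.1 * lastReflection n)
    (by
      have h := lastReflection_mul_self n
      calc lastReflection n * A.1 * lastReflection n *
            (lastReflection n * A.1 * lastReflection n)ᵀ
          = lastReflection n * (A.1 * (lastReflection n * lastReflection n) * A.1ᵀ) *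
              lastReflection n := by
            simp only [Matrix.transpose_mul, lastReflection_transpose, mul_assoc]
        _ = 1 := by rw [h, mul_one, A.mul_transpose, mul_one, h])
    (by
      have h := congrArg Matrix.det (lastReflection_mul_self n)
      rw [Matrix.det_mul, Matrix.det_one] at h
      rw [Matrix.det_mul, Matrix.det_mul, A.det_eq, mul_one, h])
  map_one' := by
    apply Subtype.ext
    change lastReflection n * 1 * lastReflection n = 1
    rw [mul_one, lastReflection_mul_self]
  map_mul' A B := by
    apply Subtype.ext
    change lastReflection n * (A.1 * B.1) * lastReflection n =
      lastReflection n * A.1 * lastReflection n * (lastReflection n * B.1 * lastReflection n)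
    calc lastReflection n * (A.1 * B.1) * lastReflection n
        = lastReflection n * A.1 * 1 * B.1 * lastReflection n := by
          simp only [mul_assoc, one_mul]
      _ = _ := by rw [← lastReflection_mul_self n]; simp only [mul_assoc]

theorem SO.contMDiff_delta (n : ℕ) : ContMDiff (soModel n) (soModel n) ∞ (SO.delta n) := by
  refine SO.contMDiff_of_apply fun i j x => ?_
  change ContMDiffAt (soModel n) 𝓘(ℝ, ℝ) ∞
    (fun A : SO n => (lastReflection n * A.1 * lastReflection n) i j) x
  exact contMDiffAt_matrix_mul (g := fun _ => lastReflection n)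
    (contMDiffAt_matrix_const_mul _ fun i j => (SO.contMDiff_apply i j).contMDiffAt)
    (fun _ _ => contMDiffAt_const) i j

/-! ### Smooth equivariant principal bundles over `S^n` -/

section Bundles

universe u v w

variable {EG : Type v} [NormedAddCommGroup EG] [NormedSpace ℝ EG] {HG : Type w}
  [TopologicalSpace HG] (I : ModelWithCorners ℝ EG HG) (G : Type u) [Group G]
  [TopologicalSpace G] [ChartedSpace HG G]

/-- A smooth principal `G`-bundle over `S^n`: a smooth manifold `Total` (modelled on the product of
the models of `S^n` and of `G`), a smooth map `proj` to `S^n` and a smooth free right action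
`rsmul` of `G` preserving the fibres, which is locally trivial: over a neighbourhood `U` of each
point there is a `G`-equivariant diffeomorphism over `U` from `proj ⁻¹' U` to `U × G`. -/
structure PrincipalBundle (n : ℕ) where
  /-- the total space -/
  Total : Type u
  [topTotal : TopologicalSpace Total]
  [chartedTotal : ChartedSpace (ModelProd (EuclideanSpace ℝ (Fin n)) HG) Total]
  [manifoldTotal : IsManifold ((𝓡 n).prod I) ∞ Total]
  /-- the projection to the base -/
  proj : Total → Sph n
  contMDiff_proj : ContMDiff ((𝓡 n).prod I) (𝓡 n) ∞ proj
  /-- the right action of the structure group -/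
  rsmul : Total → G → Total
  rsmul_one : ∀ z, rsmul z 1 = z
  rsmul_mul : ∀ z g h, rsmul z (g * h) = rsmul (rsmul z g) h
  contMDiff_rsmul : ContMDiff (((𝓡 n).prod I).prod I) ((𝓡 n).prod I) ∞
    fun p : Total × G => rsmul p.1 p.2
  free : ∀ z g, rsmul z g = z → g = 1
  proj_rsmul : ∀ z g, proj (rsmul z g) = proj z
  locally_trivial : ∀ x : Sph n, ∃ (U : Set (Sph n)) (φ : OpenPartialHomeomorph Total (Sph n × G)),
    IsOpen U ∧ x ∈ U ∧ φ.source = proj ⁻¹' U ∧ φ.target = U ×ˢ Set.univ ∧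
    ContMDiffOn ((𝓡 n).prod I) ((𝓡 n).prod I) ∞ φ φ.source ∧
    ContMDiffOn ((𝓡 n).prod I) ((𝓡 n).prod I) ∞ φ.symm φ.target ∧
    ∀ z ∈ φ.source, (φ z).1 = proj z ∧ ∀ g, (φ (rsmul z g)).2 = (φ z).2 * g

attribute [instance] PrincipalBundle.topTotal PrincipalBundle.chartedTotal
  PrincipalBundle.manifoldTotal

/-- For `ρ : SO(k) → SO(n+1)`, an `SO(k)`-equivariant principal `G`-bundle over `S^n`, where `SO(k)`
acts on `S^n` through `ρ`: a smooth principal `G`-bundle together with a smooth left action `lsmul`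
of `SO(k)` on the total space commuting with the right action of `G` and such that the projection
is equivariant. -/
structure EquivariantBundle {n k : ℕ} (ρ : SO k →* SO (n + 1)) extends PrincipalBundle I G n where
  /-- the left action -/
  lsmul : SO k → Total → Total
  lsmul_one : ∀ z, lsmul 1 z = z
  lsmul_mul : ∀ A B z, lsmul (A * B) z = lsmul A (lsmul B z)
  contMDiff_lsmul : ContMDiff ((soModel k).prod ((𝓡 n).prod I)) ((𝓡 n).prod I) ∞
    fun p : SO k × Total => lsmul p.1 p.2
  lsmul_rsmul : ∀ A z g, lsmul A (rsmul z g) = rsmul (lsmul A z) g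
  proj_lsmul : ∀ A z, proj (lsmul A z) = ρ A • proj z

/-- `(n, G)`-bundles: `SO(n)`-equivariant principal `G`-bundles over `S^n`, where `SO(n)` acts on
`S^n` fixing the poles. -/
abbrev NGBundle (n : ℕ) := EquivariantBundle I G (SO.incl n)

/-- `SO(n+1)`-equivariant principal `G`-bundles over `S^n`, for the standard action. -/
abbrev FullBundle (n : ℕ) := EquivariantBundle I G (MonoidHom.id (SO (n + 1)))

variable {I G}

/-- Restriction of an `SO(n+1)`-equivariant bundle to an `(n, G)`-bundle: the same principal
bundle, with the action restricted to `SO(n) ⊂ SO(n+1)`. -/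
def FullBundle.restrict {n : ℕ} (η : FullBundle I G n) : NGBundle I G n where
  toPrincipalBundle := η.toPrincipalBundle
  lsmul A z := η.lsmul (SO.incl n A) z
  lsmul_one z := by rw [map_one, η.lsmul_one]
  lsmul_mul A B z := by rw [map_mul, η.lsmul_mul]
  contMDiff_lsmul := by
    have h : ContMDiff ((soModel n).prod ((𝓡 n).prod I)) ((soModel (n + 1)).prod ((𝓡 n).prod I)) ∞
        (fun p : SO n × η.Total => (SO.incl n p.1, p.2)) :=
      ((SO.contMDiff_incl n).comp contMDiff_fst).prodMk contMDiff_snd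
    exact η.contMDiff_lsmul.comp h
  lsmul_rsmul A z g := η.lsmul_rsmul _ z g
  proj_lsmul A z := η.proj_lsmul _ z

/-- Isomorphism of equivariant bundles: a diffeomorphism of the total spaces over the identity of
`S^n` which is equivariant for both actions. -/
def EquivariantBundle.Iso {n k : ℕ} {ρ : SO k →* SO (n + 1)} (ξ ξ' : EquivariantBundle I G ρ) :
    Prop :=
  ∃ h : Diffeomorph ((𝓡 n).prod I) ((𝓡 n).prod I) ξ.Total ξ'.Total ∞,
    (∀ z, ξ'.proj (h z) = ξ.proj z) ∧
    (∀ z g, h (ξ.rsmul z g) = ξ'.rsmul (h z) g) ∧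
    (∀ A z, h (ξ.lsmul A z) = ξ'.lsmul A (h z))

variable (I G)

/-- Isomorphism of `(n, G)`-bundles as an equivalence relation. -/
instance NGBundle.setoid (n : ℕ) : Setoid (NGBundle I G n) where
  r := EquivariantBundle.Iso
  iseqv :=
    { refl := fun ξ => ⟨Diffeomorph.refl _ _ _, fun _ => rfl, fun _ _ => rfl, fun _ _ => rfl⟩
      symm := by
        rintro ξ ξ' ⟨h, h1, h2, h3⟩
        refine ⟨h.symm, fun z => ?_, fun z g => ?_, fun A z => ?_⟩
        · rw [← h1, h.apply_symm_apply]
        · apply h.injective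
          exact (h.apply_symm_apply _).trans
            ((h2 _ g).trans (congrArg (ξ'.rsmul · g) (h.apply_symm_apply z))).symm
        · apply h.injective
          exact (h.apply_symm_apply _).trans
            ((h3 A _).trans (congrArg (ξ'.lsmul A) (h.apply_symm_apply z))).symm
      trans := by
        rintro ξ ξ' ξ'' ⟨h, h1, h2, h3⟩ ⟨k, k1, k2, k3⟩
        refine ⟨h.trans k, fun z => ?_, fun z g => ?_, fun A z => ?_⟩
        · exact (k1 _).trans (h1 _)
        · exact (congrArg k (h2 z g)).trans (k2 _ _)
        · exact (congrArg k (h3 A z)).trans (k3 _ _) }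

/-- The set `ℰ(n, G)` of isomorphism classes of `(n, G)`-bundles. -/
def NGBundleClass (n : ℕ) : Type _ := Quotient (NGBundle.setoid I G n)

/-- Smooth homomorphisms `SO(n) → G`. -/
abbrev SOHom (n : ℕ) := ContMDiffMonoidMorphism (soModel n) I ∞ (SO n) G

/-- Two homomorphisms are equivalent when they are conjugate by an element of `G`. -/
instance SOHom.setoid (n : ℕ) : Setoid (SOHom I G n) where
  r α β := ∃ g : G, ∀ A, β A = g * α A * g⁻¹
  iseqv :=
    { refl := fun α => ⟨1, fun A => by simp⟩
      symm := by
        rintro α β ⟨g, h⟩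
        refine ⟨g⁻¹, fun A => ?_⟩
        rw [h]; group
      trans := by
        rintro α β γ ⟨g, h⟩ ⟨g', h'⟩
        refine ⟨g' * g, fun A => ?_⟩
        rw [h', h]; group }

/-- The set `ℛ(n, G)` of smooth homomorphisms `SO(n) → G` modulo conjugation in `G`. -/
def SOHomClass (n : ℕ) : Type _ := Quotient (SOHom.setoid I G n)

variable {I G}

/-- The isomorphism class of an `(n, G)`-bundle. -/
def NGBundle.toClass {n : ℕ} (ξ : NGBundle I G n) : NGBundleClass I G n := Quotient.mk _ ξ

/-- The conjugacy class of a smooth homomorphism. -/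
def SOHom.toClass {n : ℕ} (α : SOHom I G n) : SOHomClass I G n := Quotient.mk _ α

/-- The composition `α ∘ δ`. -/
def SOHom.compDelta {n : ℕ} (α : SOHom I G n) : SOHom I G n where
  toMonoidHom := (α : SO n →* G).comp (SO.delta n)
  contMDiff_toFun := ContMDiff.comp (g := α) α.contMDiff_toFun (SO.contMDiff_delta n)

/-- A class in `ℰ(n, G)` comes from an `SO(n+1)`-equivariant bundle. -/
def NGBundleClass.ComesFromFull {n : ℕ} (x : NGBundleClass I G n) : Prop :=
  ∃ η : FullBundle I G n, η.restrict.toClass = x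

/-! ### Isotropy representations -/

theorem PrincipalBundle.proj_surjective {n : ℕ} (ξ : PrincipalBundle I G n) :
    Function.Surjective ξ.proj := by
  intro x
  obtain ⟨U, φ, -, hx, hs, ht, -, -, h⟩ := ξ.locally_trivial x
  have hm : (x, (1 : G)) ∈ φ.target := by rw [ht]; exact ⟨hx, Set.mem_univ _⟩
  refine ⟨φ.symm (x, 1), ?_⟩
  rw [← (h _ (φ.map_target hm)).1, φ.right_inv hm]

theorem PrincipalBundle.exists_rsmul_eq {n : ℕ} (ξ : PrincipalBundle I G n) {z w : ξ.Total}
    (hzw : ξ.proj z = ξ.proj w) : ∃ g : G, w = ξ.rsmul z g := by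
  obtain ⟨U, φ, -, hx, hs, -, -, -, h⟩ := ξ.locally_trivial (ξ.proj z)
  have hz : z ∈ φ.source := by rw [hs]; exact hx
  have hw : w ∈ φ.source := by rw [hs, Set.mem_preimage, ← hzw]; exact hx
  refine ⟨(φ z).2⁻¹ * (φ w).2, ?_⟩
  have hzg : ξ.rsmul z ((φ z).2⁻¹ * (φ w).2) ∈ φ.source := by
    rw [hs, Set.mem_preimage, ξ.proj_rsmul]; exact hx
  apply φ.injOn hw hzg
  apply Prod.ext
  · rw [(h _ hw).1, (h _ hzg).1, ξ.proj_rsmul, hzw]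
  · rw [(h _ hz).2]; group

theorem PrincipalBundle.rsmul_injective {n : ℕ} (ξ : PrincipalBundle I G n) (z : ξ.Total) :
    Function.Injective (ξ.rsmul z) := by
  intro g g' h
  have := ξ.free z (g * g'⁻¹) (by
    rw [ξ.rsmul_mul, h, ← ξ.rsmul_mul, mul_inv_cancel, ξ.rsmul_one])
  exact mul_inv_eq_one.1 this

theorem NGBundle.fixed_of_south {n : ℕ} (ξ : NGBundle I G n) (a : ξ.Total) (ha : ξ.proj a = southPole n)
    (A : SO n) : SO.incl n A • ξ.proj a = ξ.proj a := by
  rw [ha, SO.incl_smul_southPole]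

theorem NGBundle.fixed_of_north {n : ℕ} (ξ : NGBundle I G n) (b : ξ.Total) (hb : ξ.proj b = northPole n)
    (A : SO n) : SO.incl n A • ξ.proj b = ξ.proj b := by
  rw [hb, SO.incl_smul_northPole]

section Isotropy

variable [LieGroup I ∞ G] {n k : ℕ} {ρ : SO k →* SO (n + 1)}

/-- The isotropy representation at a point `a` whose projection is fixed by `SO(k)`: the smooth
homomorphism `α : SO(k) → G` determined by `A · a = a · α(A)`. -/
def EquivariantBundle.isotropyRep (ξ : EquivariantBundle I G ρ) (a : ξ.Total)
    (ha : ∀ A, ρ A • ξ.proj a = ξ.proj a) : SOHom I G k :=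
  have h : ∀ A, ∃ g : G, ξ.lsmul A a = ξ.rsmul a g := fun A =>
    ξ.exists_rsmul_eq (by rw [ξ.proj_lsmul, ha])
  { toFun := fun A => (h A).choose
    map_one' := by
      apply ξ.rsmul_injective a
      rw [← (h 1).choose_spec, ξ.lsmul_one, ξ.rsmul_one]
    map_mul' := fun A B => by
      apply ξ.rsmul_injective a
      calc ξ.rsmul a (h (A * B)).choose = ξ.lsmul (A * B) a := (h (A * B)).choose_spec.symm
        _ = ξ.lsmul A (ξ.lsmul B a) := ξ.lsmul_mul A B a
        _ = ξ.lsmul A (ξ.rsmul a (h B).choose) := congrArg (ξ.lsmul A) (h B).choose_spec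
        _ = ξ.rsmul (ξ.lsmul A a) (h B).choose := ξ.lsmul_rsmul A a _
        _ = ξ.rsmul (ξ.rsmul a (h A).choose) (h B).choose :=
            congrArg (ξ.rsmul · (h B).choose) (h A).choose_spec
        _ = ξ.rsmul a ((h A).choose * (h B).choose) := (ξ.rsmul_mul a _ _).symm
    contMDiff_toFun := by
      obtain ⟨U, φ, -, hx, hs, -, hφ, -, hh⟩ := ξ.locally_trivial (ξ.proj a)
      have haS : a ∈ φ.source := by rw [hs]; exact hx
      have hA : ∀ A, ξ.lsmul A a ∈ φ.source := fun A => by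
        rw [hs, Set.mem_preimage, ξ.proj_lsmul, ha]; exact hx
      have e : ∀ A, (h A).choose = (φ a).2⁻¹ * (φ (ξ.lsmul A a)).2 := fun A => by
        have := (hh a haS).2 (h A).choose
        rw [← (h A).choose_spec] at this
        rw [this]; group
      have s1 : ContMDiff (soModel k) ((𝓡 n).prod I) ∞ (fun A => ξ.lsmul A a) :=
        ξ.contMDiff_lsmul.comp (contMDiff_id.prodMk contMDiff_const)
      have s2 : ContMDiff (soModel k) ((𝓡 n).prod I) ∞ (fun A => φ (ξ.lsmul A a)) :=
        hφ.comp_contMDiff s1 hA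
      have s3 : ContMDiff (soModel k) I ∞ (fun A => (φ a).2⁻¹ * (φ (ξ.lsmul A a)).2) :=
        contMDiff_const.mul (contMDiff_snd.comp s2)
      exact s3.congr e }

theorem EquivariantBundle.isotropyRep_spec (ξ : EquivariantBundle I G ρ) (a : ξ.Total)
    (ha : ∀ A, ρ A • ξ.proj a = ξ.proj a) (A : SO k) :
    ξ.lsmul A a = ξ.rsmul a (ξ.isotropyRep a ha A) :=
  (show ∃ g : G, ξ.lsmul A a = ξ.rsmul a g from
    ξ.exists_rsmul_eq (by rw [ξ.proj_lsmul, ha])).choose_spec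

/-- The class of the isotropy representation depends only on the isomorphism class of the bundle
and on the fixed point of the base. -/
theorem EquivariantBundle.isotropyRep_class_eq (ξ ξ' : EquivariantBundle I G ρ) (h : ξ.Iso ξ')
    (a : ξ.Total) (ha : ∀ A, ρ A • ξ.proj a = ξ.proj a) (a' : ξ'.Total)
    (ha' : ∀ A, ρ A • ξ'.proj a' = ξ'.proj a') (haa' : ξ.proj a = ξ'.proj a') :
    (ξ.isotropyRep a ha).toClass = (ξ'.isotropyRep a' ha').toClass := by
  obtain ⟨f, h1, h2, h3⟩ := h
  obtain ⟨g, hg⟩ := ξ'.exists_rsmul_eq (z := a') (w := f a) (by rw [h1, haa'])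
  refine Quotient.sound ⟨g, fun A => ?_⟩
  apply ξ'.rsmul_injective a'
  rw [← ξ'.isotropyRep_spec, ξ'.rsmul_mul, ξ'.rsmul_mul, ← hg, ← h2, ← ξ.isotropyRep_spec, h3, hg,
    ξ'.lsmul_rsmul, ← ξ'.rsmul_mul, mul_inv_cancel, ξ'.rsmul_one]

/-- `J(ξ) = ([α], [β])` for a bundle, where `α` and `β` are the isotropy representations at points
over the south pole and over the north pole. -/
def NGBundle.J (ξ : NGBundle I G n) : SOHomClass I G n × SOHomClass I G n :=
  ((ξ.isotropyRep _ (ξ.fixed_of_south _ (ξ.proj_surjective (southPole n)).choose_spec)).toClass,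
   (ξ.isotropyRep _ (ξ.fixed_of_north _ (ξ.proj_surjective (northPole n)).choose_spec)).toClass)

/-- The points over the poles can be chosen arbitrarily. -/
theorem NGBundle.J_eq (ξ : NGBundle I G n) (a b : ξ.Total) (ha : ξ.proj a = southPole n)
    (hb : ξ.proj b = northPole n) :
    ξ.J = ((ξ.isotropyRep a (ξ.fixed_of_south a ha)).toClass,
      (ξ.isotropyRep b (ξ.fixed_of_north b hb)).toClass) := by
  have hr : ξ.Iso ξ := (NGBundle.setoid I G n).iseqv.refl ξ
  exact Prod.ext
    (ξ.isotropyRep_class_eq ξ hr _ _ _ _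
      ((ξ.proj_surjective (southPole n)).choose_spec.trans ha.symm))
    (ξ.isotropyRep_class_eq ξ hr _ _ _ _
      ((ξ.proj_surjective (northPole n)).choose_spec.trans hb.symm))

/-- The map `J : ℰ(n, G) → ℛ(n, G) × ℛ(n, G)`. -/
def NGBundleClass.J : NGBundleClass I G n → SOHomClass I G n × SOHomClass I G n :=
  Quotient.lift NGBundle.J fun ξ ξ' h =>
    Prod.ext
      (ξ.isotropyRep_class_eq ξ' h _ _ _ _
        ((ξ.proj_surjective (southPole n)).choose_spec.trans
          (ξ'.proj_surjective (southPole n)).choose_spec.symm))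
      (ξ.isotropyRep_class_eq ξ' h _ _ _ _
        ((ξ.proj_surjective (northPole n)).choose_spec.trans
          (ξ'.proj_surjective (northPole n)).choose_spec.symm))

end Isotropy

/-! ### The Borel construction -/

variable {n : ℕ}

/-- The equivalence relation `(B A, g) ∼ (B, α(A) g)`, `A ∈ SO(n)`, on `SO(n+1) × G`. -/
def borelSetoid (α : SOHom I G n) : Setoid (SO (n + 1) × G) where
  r x y := ∃ A : SO n, x.1 = y.1 * SO.incl n A ∧ y.2 = α A * x.2
  iseqv :=
    { refl := fun x => ⟨1, by simp, by simp⟩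
      symm := by
        rintro x y ⟨A, h1, h2⟩
        exact ⟨A⁻¹, by rw [h1, map_inv]; group, by rw [h2, map_inv]; group⟩
      trans := by
        rintro x y z ⟨A, h1, h2⟩ ⟨B, h3, h4⟩
        exact ⟨B * A, by rw [h1, h3, map_mul, mul_assoc], by rw [h4, h2, map_mul, mul_assoc]⟩ }

/-- The space `SO(n+1) ×_{SO(n)} G` obtained by the Borel construction from the principal
`SO(n)`-bundle `SO(n+1) → S^n` and `α : SO(n) → G`, with the quotient topology. -/
def BorelQuotient (α : SOHom I G n) : Type u := Quotient (borelSetoid α)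

namespace BorelQuotient

variable (α : SOHom I G n)

instance : TopologicalSpace (BorelQuotient α) :=
  inferInstanceAs (TopologicalSpace (Quotient (borelSetoid α)))

/-- The class `[B, g]`. -/
def mk (B : SO (n + 1)) (g : G) : BorelQuotient α := Quotient.mk (borelSetoid α) (B, g)

variable {α}

/-- The projection, sending `[B, g]` to the last column of `B`. -/
def proj : BorelQuotient α → Sph n :=
  Quotient.lift (fun x => x.1 • northPole n) (by
    rintro x y ⟨A, h1, -⟩
    rw [h1, mul_smul, SO.incl_smul_northPole])

/-- The right action `[B, g] · g' = [B, g g']`. -/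
def rsmul (z : BorelQuotient α) (g' : G) : BorelQuotient α :=
  Quotient.map (sa := borelSetoid α) (sb := borelSetoid α) (fun x => (x.1, x.2 * g')) (by
    rintro x y ⟨A, h1, h2⟩
    exact ⟨A, h1, by rw [h2, mul_assoc]⟩) z

/-- The left action `C · [B, g] = [C B, g]`. -/
def lsmul (C : SO (n + 1)) (z : BorelQuotient α) : BorelQuotient α :=
  Quotient.map (sa := borelSetoid α) (sb := borelSetoid α) (fun x => (C * x.1, x.2)) (by
    rintro x y ⟨A, h1, h2⟩
    exact ⟨A, by rw [h1, mul_assoc], h2⟩) z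

end BorelQuotient

/-- The `SO(n+1)`-equivariant bundle `η` is obtained by the Borel construction from
`SO(n+1) → S^n` and `α`: its total space is `SO(n+1) ×_{SO(n)} G`, with the projection and the two
actions given there, and with a smooth structure for which the quotient map
`SO(n+1) × G → SO(n+1) ×_{SO(n)} G` is smooth. -/
def FullBundle.IsBorelConstruction (η : FullBundle I G n) (α : SOHom I G n) : Prop :=
  ∃ Φ : BorelQuotient α ≃ₜ η.Total,
    ContMDiff ((soModel (n + 1)).prod I) ((𝓡 n).prod I) ∞
      (fun x : SO (n + 1) × G => Φ (BorelQuotient.mk α x.1 x.2)) ∧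
    (∀ z, η.proj (Φ z) = z.proj) ∧
    (∀ z g, η.rsmul (Φ z) g = Φ (z.rsmul g)) ∧
    (∀ C z, η.lsmul C (Φ z) = Φ (BorelQuotient.lsmul C z))

end Bundles

end

open scoped Manifold ContDiff Matrix Topology

/-! For `n ≥ 1` the sphere is the homogeneous space `SO(n+1)/SO(n)`, with `SO(n)` the stabilizer of
the north pole `N`. An `SO(n+1)`-equivariant bundle is therefore determined by what happens over
`N`: if `b` lies over `N`, every point has the form `B · b · g`, and the ambiguity in `(B, g)` is
governed by the homomorphism `β` with `A · b = b · β(A)`. Changing `b` within its fibre conjugates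
`β`. Bundles with conjugate `β` are identified by `B · b · g ↦ B · b' · g` for suitable `b, b'`
(`FullBundle.exists_transport`, `FullBundle.restrict_iso_of_J_snd_eq`), and every `β` is realized by
the Borel construction (`BorelQuotient.fullBundle`).

The isotropy over the south pole is then forced. The rotation `R = diag(1, …, 1, -1, -1)` takes `N`
to the south pole and satisfies `A R = R δ(A)` for `A` in `SO(n)` (`SO.incl_mul_flip`), so the
isotropy homomorphism at `R · b` is `β ∘ δ`. Hence `J = ([β ∘ δ], [β])` (`FullBundle.J_restrict`).
With `α = β ∘ δ` and `δ² = 1` this is `([α], [α ∘ δ])`, which gives (i). For (ii), existence comes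
from the Borel construction with `β = α ∘ δ`, and uniqueness holds because the second component of
`J` alone determines the bundle.

All smoothness statements rest on the smooth local sections of `SO(n+1) → S^n`
(`SO.exists_localSection`). They express `g` smoothly in terms of the point `B · b · g`, and they
give the local trivializations, hence the charts, of the Borel quotient. -/

instance Sph.instSMul (n : ℕ) : SMul (SO (n + 1)) (Sph n) :=
  MulAction.toSemigroupAction.toSMul

/-! ### Smooth maps into `SO(n)` and the action on the sphere -/

section Smoothness

variable {E H M : Type*} [NormedAddCommGroup E] [NormedSpace ℝ E] [TopologicalSpace H]
  {I : ModelWithCorners ℝ E H} [TopologicalSpace M] [ChartedSpace H M] {n : ℕ}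

/-- A map into `SO(n)` is smooth at a point as soon as its matrix entries are. -/
theorem SO.contMDiffAt_of_apply {f : M → SO n} {x : M}
    (hf : ∀ i j, ContMDiffAt I 𝓘(ℝ, ℝ) ∞ (fun y => (f y).1 i j) x) :
    ContMDiffAt I (soModel n) ∞ f x := by
  rw [contMDiffAt_iff_target]
  refine ⟨?_, ?_⟩
  · refine Topology.IsInducing.subtypeVal.continuousAt_iff.2 ?_
    exact continuousAt_pi.2 fun i => continuousAt_pi.2 fun j => (hf i j).continuousAt
  · change ContMDiffAt I (soModel n) ∞
      (fun y => skewPart n (cayley ((f x).1ᵀ * (f y).1))) x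
    refine contMDiffAt_skewPart fun i j => contMDiffAt_cayley (fun i j => ?_) ?_ i j
    · exact contMDiffAt_matrix_const_mul _ (fun i j => hf i j) i j
    · rw [SO.transpose_mul, ← two_smul ℝ, Matrix.det_smul]
      simp

theorem SO.contMDiffAt_apply {f : M → SO n} {x : M} (hf : ContMDiffAt I (soModel n) ∞ f x)
    (i j : Fin n) : ContMDiffAt I 𝓘(ℝ, ℝ) ∞ (fun y => (f y).1 i j) x :=
  ContMDiffAt.comp (g := fun A : SO n => A.1 i j) x (SO.contMDiff_apply i j _) hf

/-- The coordinates are smooth functions on the sphere. -/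
theorem Sph.contMDiff_apply (i : Fin (n + 1)) :
    ContMDiff (𝓡 n) 𝓘(ℝ, ℝ) ∞ (fun x : Sph n => x.1 i) :=
  have := Fact.mk (@finrank_euclideanSpace_fin ℝ _ (n + 1))
  (EuclideanSpace.proj (𝕜 := ℝ) i).contDiff.contMDiff.comp (contMDiff_coe_sphere (n := n))

/-- The action of `SO(n+1)` on `S^n` is smooth. -/
theorem Sph.contMDiff_smul : ContMDiff ((soModel (n + 1)).prod (𝓡 n)) (𝓡 n) ∞
    (fun p : SO (n + 1) × Sph n => p.1 • p.2) := by
  have h : ContMDiff ((soModel (n + 1)).prod (𝓡 n)) 𝓘(ℝ, Fin (n + 1) → ℝ) ∞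
      (fun (p : SO (n + 1) × Sph n) i => (p.1 • p.2).1 i) := by
    refine contMDiff_pi_space.2 fun i => ?_
    simp only [Sph.smul_apply]
    exact ContMDiff.sum fun j _ => ((SO.contMDiff_apply i j).comp contMDiff_fst).mul
      ((Sph.contMDiff_apply j).comp contMDiff_snd)
  have := Fact.mk (@finrank_euclideanSpace_fin ℝ _ (n + 1))
  exact ContMDiff.codRestrict_sphere (n := n)
    ((EuclideanSpace.equiv (Fin (n + 1)) ℝ).symm.contDiff.contMDiff.comp h) _

end Smoothness

theorem Sph.continuous_smul_northPole {n : ℕ} :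
    Continuous (fun A : SO (n + 1) => A • northPole n) :=
  (Sph.contMDiff_smul (n := n)).continuous.comp (continuous_id.prodMk continuous_const)

theorem northPole_apply_castSucc {n : ℕ} (i : Fin n) : (northPole n).1 i.castSucc = 0 := by
  simp [northPole]

theorem northPole_apply_last (n : ℕ) : (northPole n).1 (Fin.last n) = 1 := by
  simp [northPole]

/-! ### The stabilizer of the north pole -/

theorem blockOne_injective {n : ℕ} : Function.Injective (blockOne (n := n)) := by
  intro A B h
  ext i j
  rw [← blockOne_castSucc_castSucc A, h, blockOne_castSucc_castSucc]

theorem SO.incl_injective (n : ℕ) : Function.Injective (SO.incl n) := fun _ _ h =>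
  Subtype.ext (blockOne_injective (congrArg Subtype.val h))

/-- Fixing the pole prescribes the last column of `B`. Since `B⁻¹ = Bᵀ` fixes the pole too, the last
row is prescribed as well, and `B` is a block matrix. -/
theorem SO.exists_incl_eq {n : ℕ} {B : SO (n + 1)} (hB : B • northPole n = northPole n) :
    ∃ A : SO n, SO.incl n A = B := by
  have hB' : B⁻¹ • northPole n = northPole n := by rw [inv_smul_eq_iff, hB]
  have key : blockOne (B.1.submatrix Fin.castSucc Fin.castSucc) = B.1 := by
    ext i j
    induction i using Fin.lastCases with
    | last =>
      have h : ∀ j, B.1 (Fin.last n) j = (northPole n).1 j := fun j =>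
        (smul_northPole_apply B⁻¹ j).symm.trans (by rw [hB'])
      induction j using Fin.lastCases with
      | last => rw [blockOne_last_last, h, northPole_apply_last]
      | cast j => rw [blockOne_last_castSucc, h, northPole_apply_castSucc]
    | cast i =>
      induction j using Fin.lastCases with
      | last => rw [blockOne_castSucc_last, ← smul_northPole_apply, hB, northPole_apply_castSucc]
      | cast j => rw [blockOne_castSucc_castSucc, Matrix.submatrix_apply]
  refine ⟨SO.mk (B.1.submatrix Fin.castSucc Fin.castSucc) (blockOne_injective ?_) ?_,
    Subtype.ext key⟩
  · rw [blockOne_mul, ← blockOne_transpose, key, B.mul_transpose, blockOne_one]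
  · rw [← blockOne_det, key, B.det_eq]

open Classical in
/-- The inverse of the inclusion `SO(n) ⊂ SO(n+1)`, extended by `1`. -/
noncomputable def SO.retract {n : ℕ} (B : SO (n + 1)) : SO n :=
  if h : B • northPole n = northPole n then (SO.exists_incl_eq h).choose else 1

theorem SO.incl_retract {n : ℕ} {B : SO (n + 1)} (h : B • northPole n = northPole n) :
    SO.incl n (SO.retract B) = B := by
  rw [SO.retract, dif_pos h]
  exact (SO.exists_incl_eq h).choose_spec

theorem SO.retract_incl {n : ℕ} (A : SO n) : SO.retract (SO.incl n A) = A :=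
  SO.incl_injective n (SO.incl_retract (SO.incl_smul_northPole A))

/-- This compatibility is what makes the fibre coordinate `fiberCoord` well defined on Borel
classes. -/
theorem SO.retract_mul_incl {n : ℕ} {B : SO (n + 1)} (h : B • northPole n = northPole n)
    (A : SO n) : SO.retract (B * SO.incl n A) = SO.retract B * A := by
  apply SO.incl_injective n
  rw [SO.incl_retract (by rw [mul_smul, SO.incl_smul_northPole, h]), map_mul, SO.incl_retract h]

/-- `SO.retract` takes a default value off the stabilizer of the pole, so its smoothness is stated
along maps that stay in the stabilizer. There its entries are those of the upper left block. -/
theorem SO.contMDiffAt_retract {E H M : Type*} [NormedAddCommGroup E] [NormedSpace ℝ E]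
    [TopologicalSpace H] {I : ModelWithCorners ℝ E H} [TopologicalSpace M] [ChartedSpace H M]
    {n : ℕ} {f : M → SO (n + 1)} {x : M} (hf : ContMDiffAt I (soModel (n + 1)) ∞ f x)
    (h : ∀ᶠ y in 𝓝 x, f y • northPole n = northPole n) :
    ContMDiffAt I (soModel n) ∞ (fun y => SO.retract (f y)) x := by
  refine SO.contMDiffAt_of_apply fun i j => ?_
  refine (SO.contMDiffAt_apply hf i.castSucc j.castSucc).congr_of_eventuallyEq ?_
  filter_upwards [h] with y hy
  rw [← blockOne_castSucc_castSucc (SO.retract (f y)).1 i j]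
  exact congrFun (congrFun (congrArg Subtype.val (SO.incl_retract hy)) _) _

/-! ### The rotation `diag(1, …, 1, -1, -1)` -/

theorem lastReflection_succ (n : ℕ) : lastReflection (n + 1) =
    Matrix.diagonal (Fin.snoc (α := fun _ => ℝ) (fun _ : Fin n => (1 : ℝ)) (-1)) := by
  rw [lastReflection]
  congr 1
  ext i
  induction i using Fin.lastCases with
  | last => simp
  | cast i => simp [i.isLt.ne]

theorem lastReflection_succ_det (n : ℕ) : (lastReflection (n + 1)).det = -1 := by
  rw [lastReflection_succ, Matrix.det_diagonal, Fin.prod_univ_castSucc]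
  simp

theorem lastReflection_succ_mul_blockOne {n : ℕ} (A : Matrix (Fin n) (Fin n) ℝ) :
    lastReflection (n + 1) * blockOne A = blockOne A * lastReflection (n + 1) := by
  rw [lastReflection_succ]
  ext i j
  rw [Matrix.diagonal_mul, Matrix.mul_diagonal]
  induction i using Fin.lastCases with
  | last =>
    induction j using Fin.lastCases with
    | last => simp [mul_comm]
    | cast j => simp [blockOne_last_castSucc]
  | cast i =>
    induction j using Fin.lastCases with
    | last => simp [blockOne_castSucc_last]
    | cast j => simp

/-- The rotation `diag(1, …, 1, -1, -1)`. -/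
def SO.flip (n : ℕ) (hn : 1 ≤ n) : SO (n + 1) :=
  SO.mk (blockOne (lastReflection n) * lastReflection (n + 1))
    (by
      rw [Matrix.transpose_mul, lastReflection_transpose, blockOne_transpose,
        lastReflection_transpose, mul_assoc, ← mul_assoc (lastReflection (n + 1)),
        lastReflection_mul_self, one_mul, ← blockOne_mul, lastReflection_mul_self, blockOne_one])
    (by
      -- Here `1 ≤ n` matters: for `n = 0` the first factor would be an empty matrix, of determinant
      -- `1`, and the product would have determinant `-1`.
      obtain ⟨m, rfl⟩ := Nat.exists_eq_add_of_le' hn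
      rw [Matrix.det_mul, blockOne_det, lastReflection_succ_det, lastReflection_succ_det]
      norm_num)

theorem SO.flip_apply_last {n : ℕ} (hn : 1 ≤ n) (i : Fin (n + 1)) :
    (SO.flip n hn).1 i (Fin.last n) = (southPole n).1 i := by
  change (blockOne (lastReflection n) * lastReflection (n + 1)) i (Fin.last n) = _
  rw [lastReflection_succ, Matrix.mul_diagonal]
  induction i using Fin.lastCases with
  | last => simp [blockOne_last_last, southPole]
  | cast i => simp [blockOne_castSucc_last, southPole]

theorem SO.flip_smul_northPole {n : ℕ} (hn : 1 ≤ n) :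
    SO.flip n hn • northPole n = southPole n := by
  apply Subtype.ext
  ext i
  rw [smul_northPole_apply, SO.flip_apply_last]

/-- The rotation is the block matrix of the reflection defining `δ` times a reflection in the last
coordinate, and the latter commutes with block matrices. So it normalizes `SO(n)` and induces `δ`
there; this is the source of `δ` in the theorem. -/
theorem SO.incl_mul_flip {n : ℕ} (hn : 1 ≤ n) (A : SO n) :
    SO.incl n A * SO.flip n hn = SO.flip n hn * SO.incl n (SO.delta n A) := by
  apply Subtype.ext
  change blockOne A.1 * (blockOne (lastReflection n) * lastReflection (n + 1)) =
    blockOne (lastReflection n) * lastReflection (n + 1) *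
      blockOne (lastReflection n * A.1 * lastReflection n)
  rw [mul_assoc (blockOne (lastReflection n)), lastReflection_succ_mul_blockOne, ← mul_assoc,
    ← mul_assoc, ← blockOne_mul, ← blockOne_mul, ← mul_assoc, ← mul_assoc,
    lastReflection_mul_self, one_mul]

theorem SO.delta_delta {n : ℕ} (A : SO n) : SO.delta n (SO.delta n A) = A := by
  apply Subtype.ext
  change lastReflection n * (lastReflection n * A.1 * lastReflection n) * lastReflection n = A.1
  rw [← mul_assoc, ← mul_assoc, lastReflection_mul_self, one_mul, mul_assoc,
    lastReflection_mul_self, mul_one]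

/-! ### Local sections of `SO(n+1) → S^n` -/

/-- The orthogonal matrix exchanging the north pole and `-x`. -/
noncomputable def householder {n : ℕ} (x : Sph n) : Matrix (Fin (n + 1)) (Fin (n + 1)) ℝ :=
  1 - (1 + x.1 (Fin.last n))⁻¹ •
    Matrix.vecMulVec (x.1.ofLp + (northPole n).1.ofLp) (x.1.ofLp + (northPole n).1.ofLp)

/-- With `v = x + N`, this identifies the factor in `householder` as `2 / |v|²`, so that
`householder x` is the reflection in the hyperplane orthogonal to `v`. -/
theorem add_northPole_dotProduct_self {n : ℕ} (x : Sph n) :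
    (x.1.ofLp + (northPole n).1.ofLp) ⬝ᵥ (x.1.ofLp + (northPole n).1.ofLp) =
      2 * (1 + x.1 (Fin.last n)) := by
  have h : ∀ y : Sph n, y.1.ofLp ⬝ᵥ y.1.ofLp = 1 := fun y => by
    have hy : ‖y.1‖ = 1 := by simp
    simp only [dotProduct, ← pow_two]
    rw [← EuclideanSpace.real_norm_sq_eq, hy, one_pow]
  have h' : x.1.ofLp ⬝ᵥ (northPole n).1.ofLp = x.1 (Fin.last n) := by simp [northPole]
  rw [add_dotProduct, dotProduct_add, dotProduct_add, h, h,
    dotProduct_comm (northPole n).1.ofLp, h']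
  ring

theorem householder_transpose {n : ℕ} (x : Sph n) : (householder x)ᵀ = householder x := by
  rw [householder, Matrix.transpose_sub, Matrix.transpose_one, Matrix.transpose_smul,
    Matrix.transpose_vecMulVec]

theorem householder_mul_self {n : ℕ} {x : Sph n} (hx : 1 + x.1 (Fin.last n) ≠ 0) :
    householder x * householder x = 1 := by
  have h := add_northPole_dotProduct_self x
  rw [householder]
  set v := x.1.ofLp + (northPole n).1.ofLp
  set c := 1 + x.1 (Fin.last n)
  -- The subtracted matrix is twice an orthogonal projection `P`, and `(1 - 2P)² = 1`.
  have e : (c⁻¹ • Matrix.vecMulVec v v) * (c⁻¹ • Matrix.vecMulVec v v) =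
      (2 : ℝ) • (c⁻¹ • Matrix.vecMulVec v v) := by
    rw [Matrix.smul_mul, Matrix.mul_smul, Matrix.vecMulVec_mul_vecMulVec, h,
      Matrix.vecMulVec_smul, smul_smul, smul_smul, smul_smul]
    congr 1
    field_simp
  rw [sub_mul, mul_sub, mul_sub, e, one_mul, one_mul, mul_one, two_smul]
  abel

/-- By the rank-one formula `det (1 + u vᵀ) = 1 + v · u`, the determinant is `1 - 2`. -/
theorem householder_det {n : ℕ} {x : Sph n} (hx : 1 + x.1 (Fin.last n) ≠ 0) :
    (householder x).det = -1 := by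
  have h := add_northPole_dotProduct_self x
  rw [householder]
  set v := x.1.ofLp + (northPole n).1.ofLp
  set c := 1 + x.1 (Fin.last n)
  have e : (1 : Matrix (Fin (n + 1)) (Fin (n + 1)) ℝ) - c⁻¹ • Matrix.vecMulVec v v =
      1 + Matrix.vecMulVec (-(c⁻¹ • v)) v := by
    rw [Matrix.neg_vecMulVec, Matrix.smul_vecMulVec, sub_eq_add_neg]
  rw [e, Matrix.vecMulVec_eq Unit, Matrix.det_one_add_replicateCol_mul_replicateRow,
    dotProduct_neg, dotProduct_smul, h, smul_eq_mul]
  field_simp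
  norm_num

open Classical in
/-- The rotation taking the north pole to `x` and fixing the orthogonal complement of the two
vectors, for `x` different from the south pole. -/
noncomputable def SO.rotationTo {n : ℕ} (x : Sph n) : SO (n + 1) :=
  if hx : 1 + x.1 (Fin.last n) ≠ 0 then
    SO.mk (householder x * lastReflection (n + 1))
      (by
        rw [Matrix.transpose_mul, lastReflection_transpose, householder_transpose, mul_assoc,
          ← mul_assoc (lastReflection (n + 1)), lastReflection_mul_self, one_mul,
          householder_mul_self hx])
      (by rw [Matrix.det_mul, householder_det hx, lastReflection_succ_det]; norm_num)
  else 1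

theorem SO.coe_rotationTo {n : ℕ} {x : Sph n} (hx : 1 + x.1 (Fin.last n) ≠ 0) :
    (SO.rotationTo x).1 = householder x * lastReflection (n + 1) := by
  rw [SO.rotationTo, dif_pos hx]
  rfl

/-- The last reflection sends `N` to `-N`, and the Householder reflection along `x + N` sends `-N`
to `x`. -/
theorem SO.rotationTo_smul_northPole {n : ℕ} {x : Sph n} (hx : 1 + x.1 (Fin.last n) ≠ 0) :
    SO.rotationTo x • northPole n = x := by
  apply Subtype.ext
  ext i
  rw [smul_northPole_apply, SO.coe_rotationTo hx, lastReflection_succ, Matrix.mul_diagonal,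
    householder]
  have h : (1 : Matrix (Fin (n + 1)) (Fin (n + 1)) ℝ) i (Fin.last n) = (northPole n).1 i := by
    induction i using Fin.lastCases with
    | last => simp [northPole]
    | cast i => simp [northPole]
  rw [Matrix.sub_apply, Matrix.smul_apply, Matrix.vecMulVec_apply, h, Pi.add_apply, Pi.add_apply,
    northPole_apply_last, Fin.snoc_last, smul_eq_mul]
  field_simp
  ring

theorem isOpen_one_add_last_ne_zero (n : ℕ) : IsOpen {x : Sph n | 1 + x.1 (Fin.last n) ≠ 0} :=
  isOpen_ne_fun (continuous_const.add (Sph.contMDiff_apply _).continuous) continuous_const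

theorem SO.contMDiffAt_rotationTo {n : ℕ} {x : Sph n} (hx : 1 + x.1 (Fin.last n) ≠ 0) :
    ContMDiffAt (𝓡 n) (soModel (n + 1)) ∞ SO.rotationTo x := by
  refine SO.contMDiffAt_of_apply fun i j => ?_
  have h : ContMDiffAt (𝓡 n) 𝓘(ℝ, ℝ) ∞
      (fun y : Sph n => (householder y * lastReflection (n + 1)) i j) x := by
    refine contMDiffAt_matrix_mul (g := fun _ => lastReflection (n + 1)) (fun i j => ?_)
      (fun _ _ => contMDiffAt_const) i j
    simp only [householder, Matrix.sub_apply, Matrix.smul_apply, Matrix.vecMulVec_apply,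
      Pi.add_apply, smul_eq_mul]
    refine contMDiffAt_const.sub (ContMDiffAt.mul (ContMDiffAt.inv₀ ?_ hx) (ContMDiffAt.mul ?_ ?_))
    all_goals first
      | exact contMDiffAt_const.add (Sph.contMDiff_apply _ x)
      | exact (Sph.contMDiff_apply _ x).add contMDiffAt_const
  refine h.congr_of_eventuallyEq ?_
  filter_upwards [(isOpen_one_add_last_ne_zero n).mem_nhds hx] with y hy
  rw [SO.coe_rotationTo hy]

/-- The bundle `SO(n+1) → S^n` has smooth local sections. -/
theorem SO.exists_localSection {n : ℕ} (hn : 1 ≤ n) (x₀ : Sph n) :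
    ∃ (U : Set (Sph n)) (s : Sph n → SO (n + 1)), IsOpen U ∧ x₀ ∈ U ∧
      ContMDiffOn (𝓡 n) (soModel (n + 1)) ∞ s U ∧ ∀ x ∈ U, s x • northPole n = x := by
  by_cases hx : 1 + x₀.1 (Fin.last n) ≠ 0
  · exact ⟨_, SO.rotationTo, isOpen_one_add_last_ne_zero n, hx,
      fun x hx => (SO.contMDiffAt_rotationTo hx).contMDiffWithinAt,
      fun x hx => SO.rotationTo_smul_northPole hx⟩
  -- At the south pole the previous section is transported by `R = SO.flip n hn`, giving `x ↦ R⁻¹ ·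
  -- rotationTo (R x)`. The last row of `R` is `(0, …, 0, -1)`, so `R x₀` has last coordinate `1`.
  · have hc : ContMDiff (𝓡 n) (𝓡 n) ∞ (fun x : Sph n => SO.flip n hn • x) :=
      Sph.contMDiff_smul.comp (contMDiff_const.prodMk contMDiff_id)
    refine ⟨(fun x : Sph n => SO.flip n hn • x) ⁻¹' {x : Sph n | 1 + x.1 (Fin.last n) ≠ 0},
      fun x => (SO.flip n hn)⁻¹ * SO.rotationTo (SO.flip n hn • x),
      (isOpen_one_add_last_ne_zero n).preimage hc.continuous, ?_, fun x hx => ?_, fun x hx => ?_⟩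
    · have hl : x₀.1 (Fin.last n) = -1 := by rw [not_not] at hx; linarith
      change 1 + (SO.flip n hn • x₀).1 (Fin.last n) ≠ 0
      rw [Sph.smul_apply, Fin.sum_univ_castSucc]
      have h : ∀ i : Fin n, (SO.flip n hn).1 (Fin.last n) i.castSucc = 0 := fun i => by
        change (blockOne (lastReflection n) * lastReflection (n + 1)) _ _ = 0
        rw [lastReflection_succ, Matrix.mul_diagonal, blockOne_last_castSucc, zero_mul]
      simp [h, hl, SO.flip_apply_last, southPole]
    · refine ContMDiffAt.contMDiffWithinAt ?_
      refine contMDiffAt_const.mul ?_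
      exact ContMDiffAt.comp x (SO.contMDiffAt_rotationTo hx) (hc x)
    · rw [mul_smul, SO.rotationTo_smul_northPole hx, inv_smul_smul]

theorem Sph.exists_smul_northPole {n : ℕ} (hn : 1 ≤ n) (x : Sph n) :
    ∃ B : SO (n + 1), B • northPole n = x := by
  obtain ⟨U, s, -, hx, -, hs⟩ := SO.exists_localSection hn x
  exact ⟨s x, hs x hx⟩

/-! ### Bundles over `S^n` equivariant under `SO(n+1)` -/

section FullBundles

variable {EG : Type*} [NormedAddCommGroup EG] [NormedSpace ℝ EG] {HG : Type*}
  [TopologicalSpace HG] {I : ModelWithCorners ℝ EG HG} {G : Type*} [Group G]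
  [TopologicalSpace G] [ChartedSpace HG G] {n : ℕ}

/-- Two smooth maps into the total space of a principal bundle with the same projection differ by
a smooth map to the structure group. -/
theorem PrincipalBundle.exists_contMDiffAt_rsmul_eq [LieGroup I ∞ G] (ξ : PrincipalBundle I G n)
    {E H M : Type*} [NormedAddCommGroup E] [NormedSpace ℝ E] [TopologicalSpace H]
    {J : ModelWithCorners ℝ E H} [TopologicalSpace M] [ChartedSpace H M] {f₁ f₂ : M → ξ.Total}
    {x : M} (h₁ : ContMDiffAt J ((𝓡 n).prod I) ∞ f₁ x)
    (h₂ : ContMDiffAt J ((𝓡 n).prod I) ∞ f₂ x)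
    (h : ∀ᶠ y in 𝓝 x, ξ.proj (f₁ y) = ξ.proj (f₂ y)) :
    ∃ g : M → G, ContMDiffAt J I ∞ g x ∧ ∀ᶠ y in 𝓝 x, f₂ y = ξ.rsmul (f₁ y) (g y) := by
  obtain ⟨U, φ, -, hx, hs, -, hφ, -, hh⟩ := ξ.locally_trivial (ξ.proj (f₁ x))
  have hx₁ : f₁ x ∈ φ.source := by rw [hs]; exact hx
  have hx₂ : f₂ x ∈ φ.source := by rw [hs, Set.mem_preimage, ← h.self_of_nhds]; exact hx
  have s : ∀ {f : M → ξ.Total}, ContMDiffAt J ((𝓡 n).prod I) ∞ f x → f x ∈ φ.source →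
      ContMDiffAt J I ∞ (fun y => (φ (f y)).2) x := fun hf hfx =>
    contMDiffAt_snd.comp x ((hφ.contMDiffAt (φ.open_source.mem_nhds hfx)).comp x hf)
  -- The difference of two points of one fibre is the quotient of their `G`-coordinates in a single
  -- local trivialization.
  refine ⟨fun y => (φ (f₁ y)).2⁻¹ * (φ (f₂ y)).2, (s h₁ hx₁).inv.mul (s h₂ hx₂), ?_⟩
  filter_upwards [h, h₁.continuousAt.preimage_mem_nhds (φ.open_source.mem_nhds hx₁),
    h₂.continuousAt.preimage_mem_nhds (φ.open_source.mem_nhds hx₂)] with y hy hy₁ hy₂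
  obtain ⟨g, hg⟩ := ξ.exists_rsmul_eq hy
  rw [hg, (hh _ hy₁).2, inv_mul_cancel_left]

/-- The isotropy representations at points over the two poles exchanged by the rotation
`diag(1, …, 1, -1, -1)` differ by `δ`. -/
theorem FullBundle.isotropyRep_flip [LieGroup I ∞ G] (hn : 1 ≤ n) (η : FullBundle I G n)
    (b : η.Total) (hb : ∀ A, SO.incl n A • η.restrict.proj b = η.restrict.proj b)
    (ha : ∀ A, SO.incl n A • η.restrict.proj (η.lsmul (SO.flip n hn) b) =
      η.restrict.proj (η.lsmul (SO.flip n hn) b)) (A : SO n) :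
    η.restrict.isotropyRep (η.lsmul (SO.flip n hn) b) ha A =
      η.restrict.isotropyRep b hb (SO.delta n A) := by
  apply η.rsmul_injective (η.lsmul (SO.flip n hn) b)
  have h₁ : η.lsmul (SO.incl n A) (η.lsmul (SO.flip n hn) b) =
      η.rsmul (η.lsmul (SO.flip n hn) b) (η.restrict.isotropyRep _ ha A) :=
    η.restrict.isotropyRep_spec _ ha A
  have h₂ : η.lsmul (SO.incl n (SO.delta n A)) b =
      η.rsmul b (η.restrict.isotropyRep b hb (SO.delta n A)) :=
    η.restrict.isotropyRep_spec b hb _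
  rw [← h₁, ← η.lsmul_rsmul, ← h₂, ← η.lsmul_mul, ← η.lsmul_mul, SO.incl_mul_flip]

theorem SOHom.compDelta_apply (α : SOHom I G n) (A : SO n) : α.compDelta A = α (SO.delta n A) :=
  rfl

theorem SOHom.compDelta_compDelta (α : SOHom I G n) : α.compDelta.compDelta = α := by
  apply DFunLike.ext
  intro A
  rw [SOHom.compDelta_apply, SOHom.compDelta_apply, SO.delta_delta]

/-- The value of `J` on the restriction of an `SO(n+1)`-equivariant bundle in terms of the isotropy
representation over the north pole. -/
theorem FullBundle.J_restrict [LieGroup I ∞ G] (hn : 1 ≤ n) (η : FullBundle I G n)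
    (b : η.restrict.Total) (hb : η.restrict.proj b = northPole n) :
    η.restrict.J = ((η.restrict.isotropyRep b (η.restrict.fixed_of_north b hb)).compDelta.toClass,
      (η.restrict.isotropyRep b (η.restrict.fixed_of_north b hb)).toClass) := by
  -- `J` may be computed at any points over the poles, so the point over the south pole is taken to
  -- be the rotated `b`.
  have ha : η.restrict.proj (η.lsmul (SO.flip n hn) b) = southPole n := by
    refine (η.proj_lsmul _ _).trans ?_
    rw [MonoidHom.id_apply, ← SO.flip_smul_northPole hn]
    exact congrArg _ hb
  rw [NGBundle.J_eq _ _ b ha hb]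
  refine Prod.ext (congrArg SOHom.toClass (DFunLike.ext _ _ fun A => ?_)) rfl
  exact η.isotropyRep_flip hn b (η.restrict.fixed_of_north b hb) _ A

/-- Every point of the total space is `B · b · g` for a given `b` over the north pole. -/
theorem FullBundle.exists_eq_lsmul_rsmul (hn : 1 ≤ n) (η : FullBundle I G n) {b : η.Total}
    (hb : η.proj b = northPole n) (z : η.Total) : ∃ B g, z = η.rsmul (η.lsmul B b) g := by
  obtain ⟨B, hB⟩ := Sph.exists_smul_northPole hn (η.proj z)
  obtain ⟨g, hg⟩ := η.exists_rsmul_eq (z := η.lsmul B b) (w := z) (by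
    rw [η.proj_lsmul, MonoidHom.id_apply, hb, hB])
  exact ⟨B, g, hg⟩

/-- The map `B · b · g ↦ B · b' · g`, where the points `b` and `b'` over the north pole have the same
isotropy representation. -/
theorem FullBundle.exists_transport [LieGroup I ∞ G] (hn : 1 ≤ n) (η η' : FullBundle I G n)
    {b : η.Total} {b' : η'.Total} (hb : η.proj b = northPole n)
    (h : ∀ A g, η.lsmul (SO.incl n A) b = η.rsmul b g →
      η'.lsmul (SO.incl n A) b' = η'.rsmul b' g) :
    ∃ F : η.Total → η'.Total, ContMDiff ((𝓡 n).prod I) ((𝓡 n).prod I) ∞ F ∧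
      ∀ B g, F (η.rsmul (η.lsmul B b) g) = η'.rsmul (η'.lsmul B b') g := by
  -- Independence of the presentation `z = B · b · g` is built into the existence statement, so that
  -- any choice of `w` is the desired value. Two presentations have `B₁ = B A` with `A` in `SO(n)`;
  -- cancelling `B` leaves `A · b = b · (g g₁⁻¹)`, a relation which `h` carries over to `b'`.
  have wd : ∀ z, ∃ w, ∀ B g, z = η.rsmul (η.lsmul B b) g → w = η'.rsmul (η'.lsmul B b') g := by
    intro z
    obtain ⟨B, g, rfl⟩ := η.exists_eq_lsmul_rsmul hn hb z
    refine ⟨η'.rsmul (η'.lsmul B b') g, fun B₁ g₁ e => ?_⟩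
    have hB : (B⁻¹ * B₁) • northPole n = northPole n := by
      have := congrArg η.proj e
      rw [η.proj_rsmul, η.proj_rsmul, η.proj_lsmul, η.proj_lsmul, hb] at this
      rw [mul_smul, inv_smul_eq_iff]
      exact this.symm
    obtain ⟨A, hA⟩ := SO.exists_incl_eq hB
    have hB₁ : B₁ = B * SO.incl n A := by rw [hA, mul_inv_cancel_left]
    have e₁ : η.lsmul (SO.incl n A) b = η.rsmul b (g * g₁⁻¹) := by
      have e₂ : η.rsmul (η.lsmul B b) (g * g₁⁻¹) = η.lsmul B (η.lsmul (SO.incl n A) b) := by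
        rw [η.rsmul_mul, e, ← η.rsmul_mul, mul_inv_cancel, η.rsmul_one, hB₁, η.lsmul_mul]
      have e₃ := congrArg (η.lsmul B⁻¹) e₂
      rw [← η.lsmul_rsmul, ← η.lsmul_mul, ← η.lsmul_mul, inv_mul_cancel, η.lsmul_one,
        η.lsmul_one] at e₃
      exact e₃.symm
    rw [hB₁, η'.lsmul_mul, h A _ e₁, η'.lsmul_rsmul, ← η'.rsmul_mul, inv_mul_cancel_right]
  choose F hF using wd
  refine ⟨F, fun z => ?_, fun B g => hF _ B g rfl⟩
  -- Near `z` one may take `B = s (proj y)`. The remaining factor `g y` is then smooth, and so is `F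
  -- y = s (proj y) · b' · g y`.
  obtain ⟨U, s, hU, hz, hs, hsec⟩ := SO.exists_localSection hn (η.proj z)
  have hUz : ∀ᶠ y in 𝓝 z, η.proj y ∈ U :=
    η.contMDiff_proj.continuous.continuousAt.preimage_mem_nhds (hU.mem_nhds hz)
  have hsz : ContMDiffAt ((𝓡 n).prod I) (soModel (n + 1)) ∞ (fun y => s (η.proj y)) z :=
    ContMDiffAt.comp z (hs.contMDiffAt (hU.mem_nhds hz)) (η.contMDiff_proj z)
  have hb₁ : ContMDiffAt ((𝓡 n).prod I) ((𝓡 n).prod I) ∞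
      (fun y => η.lsmul (s (η.proj y)) b) z :=
    ContMDiffAt.comp (g := fun p : SO (n + 1) × η.Total => η.lsmul p.1 p.2) z
      (η.contMDiff_lsmul _) (hsz.prodMk contMDiffAt_const)
  have hb₂ : ContMDiffAt ((𝓡 n).prod I) ((𝓡 n).prod I) ∞
      (fun y => η'.lsmul (s (η.proj y)) b') z :=
    ContMDiffAt.comp (g := fun p : SO (n + 1) × η'.Total => η'.lsmul p.1 p.2) z
      (η'.contMDiff_lsmul _) (hsz.prodMk contMDiffAt_const)
  obtain ⟨g, hg, hgz⟩ := η.exists_contMDiffAt_rsmul_eq (f₂ := fun y => y) hb₁ contMDiffAt_id (by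
    filter_upwards [hUz] with y hy
    rw [η.proj_lsmul, MonoidHom.id_apply, hb, hsec _ hy])
  have key : ContMDiffAt ((𝓡 n).prod I) ((𝓡 n).prod I) ∞
      (fun y => η'.rsmul (η'.lsmul (s (η.proj y)) b') (g y)) z :=
    ContMDiffAt.comp (g := fun p : η'.Total × G => η'.rsmul p.1 p.2) z
      (η'.contMDiff_rsmul _) (hb₂.prodMk hg)
  exact key.congr_of_eventuallyEq (hgz.mono fun y hy => hF y _ _ hy)

/-- `SO(n+1)`-equivariant bundles with the same isotropy representation over the north pole are
isomorphic. -/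
theorem FullBundle.iso_of_isotropy [LieGroup I ∞ G] (hn : 1 ≤ n) (η η' : FullBundle I G n)
    {b : η.Total} {b' : η'.Total} (hb : η.proj b = northPole n) (hb' : η'.proj b' = northPole n)
    (h : ∀ A g, η.lsmul (SO.incl n A) b = η.rsmul b g ↔
      η'.lsmul (SO.incl n A) b' = η'.rsmul b' g) : η.Iso η' := by
  obtain ⟨F, hF, hF'⟩ := η.exists_transport hn η' hb fun A g => (h A g).1
  obtain ⟨F₁, hF₁, hF₁'⟩ := η'.exists_transport hn η hb' fun A g => (h A g).2
  -- The inverse is the transport in the opposite direction, hence smooth. Each remaining identity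
  -- is checked on points `B · b · g`.
  refine ⟨⟨⟨F, F₁, fun z => ?_, fun z => ?_⟩, hF, hF₁⟩, fun z => ?_, fun z g' => ?_,
    fun C z => ?_⟩
  · obtain ⟨B, g, rfl⟩ := η.exists_eq_lsmul_rsmul hn hb z
    rw [hF', hF₁']
  · obtain ⟨B, g, rfl⟩ := η'.exists_eq_lsmul_rsmul hn hb' z
    rw [hF₁', hF']
  · obtain ⟨B, g, rfl⟩ := η.exists_eq_lsmul_rsmul hn hb z
    change η'.proj (F _) = _
    rw [hF', η.proj_rsmul, η'.proj_rsmul, η.proj_lsmul, η'.proj_lsmul, hb, hb']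
  · obtain ⟨B, g, rfl⟩ := η.exists_eq_lsmul_rsmul hn hb z
    change F _ = η'.rsmul (F _) _
    rw [hF', ← η.rsmul_mul, hF', η'.rsmul_mul]
  · obtain ⟨B, g, rfl⟩ := η.exists_eq_lsmul_rsmul hn hb z
    change F _ = η'.lsmul _ (F _)
    rw [hF', η.lsmul_rsmul, ← η.lsmul_mul, hF', η'.lsmul_mul, η'.lsmul_rsmul]

/-- The restriction of an `SO(n+1)`-equivariant bundle to `SO(n)` is determined up to isomorphism
by the class of the isotropy representation over the north pole. -/
theorem FullBundle.restrict_iso_of_J_snd_eq [LieGroup I ∞ G] (hn : 1 ≤ n) (η η' : FullBundle I G n)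
    (h : η.restrict.J.2 = η'.restrict.J.2) : η.restrict.Iso η'.restrict := by
  obtain ⟨b, hb⟩ := η.proj_surjective (northPole n)
  obtain ⟨b', hb'⟩ := η'.proj_surjective (northPole n)
  rw [η.J_restrict hn b hb, η'.J_restrict hn b' hb'] at h
  obtain ⟨k, hk⟩ := Quotient.exact h
  have h₁ : ∀ A, η.lsmul (SO.incl n A) b = η.rsmul b (η.restrict.isotropyRep b _ A) :=
    η.restrict.isotropyRep_spec b (η.restrict.fixed_of_north b hb)
  have h₂ : ∀ A, η'.lsmul (SO.incl n A) b' = η'.rsmul b' (η'.restrict.isotropyRep b' _ A) :=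
    η'.restrict.isotropyRep_spec b' (η'.restrict.fixed_of_north b' hb')
  -- If `β' = k β k⁻¹` is the isotropy at `b'`, then the isotropy at `b' · k` is exactly `β`.
  obtain ⟨f, f₁, f₂, f₃⟩ := η.iso_of_isotropy hn η' (b := b) (b' := η'.rsmul b' k) hb
    (by rw [η'.proj_rsmul, hb']) fun A g => by
      rw [h₁, η'.lsmul_rsmul, h₂, hk, ← η'.rsmul_mul, ← η'.rsmul_mul, inv_mul_cancel_right,
        (η.rsmul_injective b).eq_iff, (η'.rsmul_injective b').eq_iff, mul_right_inj]
  exact ⟨f, f₁, f₂, fun A z => f₃ (SO.incl n A) z⟩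

end FullBundles

/-! ### Manifold structures defined by local homeomorphisms to a manifold -/

section GluedManifold

variable {E H M T : Type*} [NormedAddCommGroup E] [NormedSpace ℝ E] [TopologicalSpace H]
  (J : ModelWithCorners ℝ E H) [TopologicalSpace M] [ChartedSpace H M]
  [TopologicalSpace T] (φ : T → OpenPartialHomeomorph T M)

/-- The charts on `T` obtained by composing local homeomorphisms to `M` with charts of `M`. -/
abbrev chartedSpaceOfLocalHomeomorph (hφ : ∀ z, z ∈ (φ z).source) : ChartedSpace H T where
  atlas := Set.range fun z => φ z ≫ₕ chartAt H (φ z z)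
  chartAt z := φ z ≫ₕ chartAt H (φ z z)
  mem_chart_source z := ⟨hφ z, mem_chart_source _ _⟩
  chart_mem_atlas z := ⟨z, rfl⟩

variable [IsManifold J ∞ M]

/-- A change of charts on `T` is a transition `φ w ∘ (φ z)⁻¹`, smooth by hypothesis, between two
charts of `M`. -/
theorem isManifold_of_localHomeomorph (hφ : ∀ z, z ∈ (φ z).source)
    (hs : ∀ z w, ContMDiffOn J J ∞ (φ w ∘ (φ z).symm) ((φ z).symm ≫ₕ φ w).source) :
    @IsManifold ℝ _ E _ _ H _ J ∞ T _ (chartedSpaceOfLocalHomeomorph φ hφ) := by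
  let := chartedSpaceOfLocalHomeomorph (H := H) φ hφ
  apply isManifold_of_contDiffOn
  rintro _ _ ⟨z, rfl⟩ ⟨w, rfl⟩
  have key : ContMDiffOn J J ∞ (chartAt H (φ w w) ∘ (φ w ∘ (φ z).symm) ∘ (chartAt H (φ z z)).symm)
      ((φ z ≫ₕ chartAt H (φ z z)).symm ≫ₕ (φ w ≫ₕ chartAt H (φ w w))).source := by
    refine contMDiffOn_chart.comp ((hs z w).comp
      (contMDiffOn_chart_symm.mono fun x hx => hx.1.1) fun x hx => ?_) fun x hx => ?_
    · exact ⟨hx.1.2, hx.2.1⟩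
    · exact hx.2.2
  -- The charts of `H` are the identity, so the two base points only fill in arguments; any points
  -- of `H` would do.
  have := (contMDiffOn_iff.1 key).2 (J.symm (J (chartAt H (φ z z) (φ z z))))
    (J.symm (J (chartAt H (φ z z) (φ z z))))
  simp only [mfld_simps] at this ⊢
  refine this.mono ?_
  intro x hx
  simp only [mfld_simps] at hx ⊢
  tauto

/-- Only `φ w` is tied to the chart at `w`. Near `w` the map `φ z` factors as the transition `φ z ∘
(φ w)⁻¹` after `φ w`, and `φ w` is the chart at `w` followed by an inverse chart of `M`. -/
theorem contMDiffOn_localHomeomorph (hφ : ∀ z, z ∈ (φ z).source)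
    (hs : ∀ z w, ContMDiffOn J J ∞ (φ w ∘ (φ z).symm) ((φ z).symm ≫ₕ φ w).source) (z : T) :
    letI := chartedSpaceOfLocalHomeomorph (H := H) φ hφ
    ContMDiffOn J J ∞ (φ z) (φ z).source := by
  let := chartedSpaceOfLocalHomeomorph (H := H) φ hφ
  have := isManifold_of_localHomeomorph J φ hφ hs
  intro w hw
  refine ContMDiffAt.contMDiffWithinAt ?_
  have h₁ : ContMDiffAt J J ∞ (chartAt H w) w :=
    contMDiffAt_of_mem_maximalAtlas (IsManifold.chart_mem_maximalAtlas w) (mem_chart_source _ w)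
  have h₂ : ContMDiffAt J J ∞ (chartAt H (φ w w)).symm (chartAt H w w) :=
    contMDiffOn_chart_symm.contMDiffAt
      ((chartAt H (φ w w)).open_target.mem_nhds (mem_chart_target _ _))
  have e : (chartAt H (φ w w)).symm (chartAt H w w) = φ w w :=
    (chartAt H (φ w w)).left_inv (mem_chart_source _ _)
  have h₃ : ContMDiffAt J J ∞ (φ z ∘ (φ w).symm) (φ w w) := by
    refine (hs w z).contMDiffAt (((φ w).symm ≫ₕ φ z).open_source.mem_nhds
      ⟨(φ w).map_source (hφ w), ?_⟩)
    change (φ w).symm (φ w w) ∈ (φ z).source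
    rw [(φ w).left_inv (hφ w)]
    exact hw
  have key := (h₃.comp_of_eq h₂ e).comp w h₁
  refine key.congr_of_eventuallyEq ?_
  filter_upwards [(chartAt H w).open_source.mem_nhds (mem_chart_source _ w)] with y hy
  change φ z y = φ z ((φ w).symm ((chartAt H (φ w w)).symm (chartAt H (φ w w) (φ w y))))
  rw [(chartAt H (φ w w)).left_inv (show φ w y ∈ _ from hy.2), (φ w).left_inv hy.1]

/-- With `w = (φ z)⁻¹ m`, near `m` the inverse of `φ z` is the transition to `φ w`, then a chart of
`M`, then the inverse of the chart of `T` at `w`. -/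
theorem contMDiffOn_localHomeomorph_symm (hφ : ∀ z, z ∈ (φ z).source)
    (hs : ∀ z w, ContMDiffOn J J ∞ (φ w ∘ (φ z).symm) ((φ z).symm ≫ₕ φ w).source) (z : T) :
    letI := chartedSpaceOfLocalHomeomorph (H := H) φ hφ
    ContMDiffOn J J ∞ (φ z).symm (φ z).target := by
  let := chartedSpaceOfLocalHomeomorph (H := H) φ hφ
  have := isManifold_of_localHomeomorph J φ hφ hs
  intro m hm
  refine ContMDiffAt.contMDiffWithinAt ?_
  set w := (φ z).symm m with hw
  have h₁ : ContMDiffAt J J ∞ (φ w ∘ (φ z).symm) m :=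
    (hs z w).contMDiffAt (((φ z).symm ≫ₕ φ w).open_source.mem_nhds ⟨hm, hφ w⟩)
  have h₂ : ContMDiffAt J J ∞ (chartAt H (φ w w)) (φ w w) :=
    contMDiffAt_of_mem_maximalAtlas (IsManifold.chart_mem_maximalAtlas _) (mem_chart_source _ _)
  have h₃ : ContMDiffAt J J ∞ (chartAt H w).symm (chartAt H (φ w w) (φ w w)) :=
    contMDiffOn_chart_symm.contMDiffAt
      ((chartAt H w).open_target.mem_nhds (mem_chart_target H w))
  have key := h₃.comp m (h₂.comp m h₁)
  refine key.congr_of_eventuallyEq ?_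
  filter_upwards [((φ z).open_target.mem_nhds hm), h₁.continuousAt.preimage_mem_nhds
    ((chartAt H (φ w w)).open_source.mem_nhds (mem_chart_source H (φ w w))),
    ((φ z).symm.continuousAt hm).preimage_mem_nhds ((φ w).open_source.mem_nhds (hφ w))]
    with y hy hy₁ hy₂
  change (φ z).symm y = (φ w).symm ((chartAt H (φ w w)).symm (chartAt H (φ w w)
    (φ w ((φ z).symm y))))
  rw [(chartAt H (φ w w)).left_inv (show φ w ((φ z).symm y) ∈ _ from hy₁), (φ w).left_inv hy₂]

end GluedManifold

/-- Near each point of `S^n` the projection `SO(n+1) → S^n` has a section which is smooth there. -/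
theorem SO.exists_section {n : ℕ} (hn : 1 ≤ n) (x₀ : Sph n) :
    ∃ (s : Sph n → SO (n + 1)) (U : Set (Sph n)), IsOpen U ∧ x₀ ∈ U ∧
      ContMDiffOn (𝓡 n) (soModel (n + 1)) ∞ s U ∧ ∀ x, s x • northPole n = x := by
  classical
  obtain ⟨U, s, hU, hx, hs, hsec⟩ := SO.exists_localSection hn x₀
  -- The section is extended to the whole sphere without continuity, so that fibre coordinates are
  -- total functions and their algebraic identities need no domain condition.
  refine ⟨fun x => if x ∈ U then s x else (Sph.exists_smul_northPole hn x).choose, U, hU, hx,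
    hs.congr fun x hx => if_pos hx, fun x => ?_⟩
  by_cases h : x ∈ U
  · simp only [if_pos h, hsec x h]
  · simp only [if_neg h, (Sph.exists_smul_northPole hn x).choose_spec]

namespace BorelQuotient

/-! ### The smooth structure of the Borel construction -/

universe u v w

variable {EG : Type v} [NormedAddCommGroup EG] [NormedSpace ℝ EG] {HG : Type w}
  [TopologicalSpace HG] {I : ModelWithCorners ℝ EG HG} {G : Type u} [Group G]
  [TopologicalSpace G] [ChartedSpace HG G] {n : ℕ} {α : SOHom I G n}

theorem isQuotientMap_mk :
    Topology.IsQuotientMap (fun p : SO (n + 1) × G => BorelQuotient.mk α p.1 p.2) :=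
  isQuotientMap_quotient_mk'

theorem mk_surjective (z : BorelQuotient α) : ∃ B g, z = BorelQuotient.mk α B g := by
  obtain ⟨p, hp⟩ := isQuotientMap_mk.surjective z
  exact ⟨p.1, p.2, hp.symm⟩

theorem proj_mk (B : SO (n + 1)) (g : G) : (BorelQuotient.mk α B g).proj = B • northPole n := rfl

theorem rsmul_mk (B : SO (n + 1)) (g g' : G) :
    (BorelQuotient.mk α B g).rsmul g' = BorelQuotient.mk α B (g * g') := rfl

theorem lsmul_mk (C B : SO (n + 1)) (g : G) :
    BorelQuotient.lsmul C (BorelQuotient.mk α B g) = BorelQuotient.mk α (C * B) g := rfl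

theorem mk_mul_incl (B : SO (n + 1)) (A : SO n) (g : G) :
    BorelQuotient.mk α (B * SO.incl n A) g = BorelQuotient.mk α B (α A * g) :=
  Quotient.sound ⟨A, rfl, rfl⟩

theorem proj_rsmul (z : BorelQuotient α) (g : G) : (z.rsmul g).proj = z.proj := by
  obtain ⟨B, h, rfl⟩ := z.mk_surjective
  rfl

theorem continuous_proj : Continuous (BorelQuotient.proj (α := α)) :=
  isQuotientMap_mk.continuous_iff.2 (Sph.continuous_smul_northPole.comp continuous_fst)

theorem inv_section_mul_smul {s : Sph n → SO (n + 1)} (hs : ∀ x, s x • northPole n = x)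
    (B : SO (n + 1)) : ((s (B • northPole n))⁻¹ * B) • northPole n = northPole n := by
  rw [mul_smul, inv_smul_eq_iff, hs]

/-! ### Local trivializations of the Borel quotient. -/

section Trivialization

variable (s : Sph n → SO (n + 1)) (hs : ∀ x, s x • northPole n = x)

/-- The `G`-component of a point of `SO(n+1) ×_{SO(n)} G` with respect to a section of
`SO(n+1) → S^n`. -/
noncomputable def fiberCoord (z : BorelQuotient α) : G :=
  Quotient.lift (s := borelSetoid α)
    -- If `x` is the last column of `B`, then `B = s(x) A` with `A` in `SO(n)`, and `[B, g] = [s(x),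
    -- α(A) g]`.
    (fun p => α (SO.retract ((s (p.1 • northPole n))⁻¹ * p.1)) * p.2) (by
      rintro x y ⟨A, h₁, h₂⟩
      simp only [h₁, h₂, mul_smul, SO.incl_smul_northPole]
      rw [← mul_assoc, SO.retract_mul_incl (inv_section_mul_smul hs _), map_mul, mul_assoc]) z

theorem fiberCoord_mk (B : SO (n + 1)) (g : G) : fiberCoord s hs (BorelQuotient.mk α B g) =
    α (SO.retract ((s (B • northPole n))⁻¹ * B)) * g := rfl

theorem fiberCoord_rsmul (z : BorelQuotient α) (g : G) :
    fiberCoord s hs (z.rsmul g) = fiberCoord s hs z * g := by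
  obtain ⟨B, h, rfl⟩ := z.mk_surjective
  rw [rsmul_mk, fiberCoord_mk, fiberCoord_mk, mul_assoc]

theorem mk_fiberCoord (z : BorelQuotient α) :
    BorelQuotient.mk α (s z.proj) (fiberCoord s hs z) = z := by
  obtain ⟨B, g, rfl⟩ := z.mk_surjective
  rw [fiberCoord_mk, proj_mk, ← mk_mul_incl, SO.incl_retract (inv_section_mul_smul hs B),
    mul_inv_cancel_left]

theorem fiberCoord_mk_section (x : Sph n) (g : G) :
    fiberCoord s hs (BorelQuotient.mk α (s x) g) = g := by
  rw [fiberCoord_mk, hs, inv_mul_cancel, ← map_one (SO.incl n), SO.retract_incl, map_one, one_mul]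

variable [LieGroup I ∞ G]

/-- Smoothness is stated upstairs on `SO(n+1) × G`, where a smooth structure already exists. It
yields continuity of the trivializations through the quotient topology, and smoothness of their
transition maps. -/
theorem contMDiffAt_fiberCoord_mk {U : Set (Sph n)} (hU : IsOpen U)
    (hsU : ContMDiffOn (𝓡 n) (soModel (n + 1)) ∞ s U) {p : SO (n + 1) × G}
    (hp : p.1 • northPole n ∈ U) :
    ContMDiffAt ((soModel (n + 1)).prod I) I ∞
      (fun p : SO (n + 1) × G => fiberCoord s hs (BorelQuotient.mk α p.1 p.2)) p := by
  have h₁ : ContMDiffAt ((soModel (n + 1)).prod I) (𝓡 n) ∞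
      (fun p : SO (n + 1) × G => p.1 • northPole n) p :=
    ContMDiffAt.comp (g := fun q : SO (n + 1) × Sph n => q.1 • q.2) p (Sph.contMDiff_smul _)
      (contMDiffAt_fst.prodMk contMDiffAt_const)
  have h₂ : ContMDiffAt ((soModel (n + 1)).prod I) (soModel (n + 1)) ∞
      (fun p : SO (n + 1) × G => (s (p.1 • northPole n))⁻¹ * p.1) p :=
    (ContMDiffAt.comp p (hsU.contMDiffAt (hU.mem_nhds hp)) h₁).inv.mul contMDiffAt_fst
  have h₃ := SO.contMDiffAt_retract h₂
    (Filter.Eventually.of_forall fun q => inv_section_mul_smul hs q.1)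
  exact (ContMDiffAt.comp (g := α) p (α.contMDiff_toFun _) h₃).mul contMDiffAt_snd

/-- The trivialization of `SO(n+1) ×_{SO(n)} G → S^n` defined by a section of `SO(n+1) → S^n`. -/
noncomputable def trivialization (U : Set (Sph n)) (hU : IsOpen U)
    (hsU : ContMDiffOn (𝓡 n) (soModel (n + 1)) ∞ s U) :
    OpenPartialHomeomorph (BorelQuotient α) (Sph n × G) where
  toFun z := (z.proj, fiberCoord s hs z)
  invFun p := BorelQuotient.mk α (s p.1) p.2
  source := BorelQuotient.proj ⁻¹' U
  target := U ×ˢ Set.univ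
  map_source' _ hz := ⟨hz, Set.mem_univ _⟩
  map_target' p hp := by
    rw [Set.mem_preimage, proj_mk, hs]
    exact hp.1
  left_inv' z _ := mk_fiberCoord s hs z
  right_inv' p _ := Prod.ext (hs p.1) (fiberCoord_mk_section s hs p.1 p.2)
  open_source := hU.preimage continuous_proj
  open_target := hU.prod isOpen_univ
  continuousOn_toFun := by
    refine continuous_proj.continuousOn.prodMk ?_
    -- Over an open set, continuity on the quotient can be tested on `SO(n+1) × G`.
    rw [isQuotientMap_mk.continuousOn_isOpen_iff (hU.preimage continuous_proj)]
    exact fun p hp => (contMDiffAt_fiberCoord_mk s hs hU hsU hp).continuousAt.continuousWithinAt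
  continuousOn_invFun :=
    isQuotientMap_mk.continuous.comp_continuousOn
      ((hsU.continuousOn.comp continuousOn_fst fun p hp => hp.1).prodMk continuousOn_snd)

theorem contMDiffAt_prod_fiberCoord_mk {U : Set (Sph n)} (hU : IsOpen U)
    (hsU : ContMDiffOn (𝓡 n) (soModel (n + 1)) ∞ s U) {p : SO (n + 1) × G}
    (hp : p.1 • northPole n ∈ U) :
    ContMDiffAt ((soModel (n + 1)).prod I) ((𝓡 n).prod I) ∞ (fun p : SO (n + 1) × G =>
      (p.1 • northPole n, fiberCoord s hs (BorelQuotient.mk α p.1 p.2))) p := by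
  have h : ContMDiffAt ((soModel (n + 1)).prod I) (𝓡 n) ∞
      (fun p : SO (n + 1) × G => p.1 • northPole n) p :=
    ContMDiffAt.comp (g := fun q : SO (n + 1) × Sph n => q.1 • q.2) p (Sph.contMDiff_smul _)
      (contMDiffAt_fst.prodMk contMDiffAt_const)
  exact h.prodMk (contMDiffAt_fiberCoord_mk s hs hU hsU hp)

/-- The inverse trivialization lifts to `(x, g) ↦ (s x, g)` in `SO(n+1) × G`, so the transition map
is a composition of smooth maps that avoids any smooth structure on the quotient. -/
theorem contMDiffOn_trivialization_comp_symm (U : Set (Sph n)) (hU : IsOpen U)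
    (hsU : ContMDiffOn (𝓡 n) (soModel (n + 1)) ∞ s U) (s' : Sph n → SO (n + 1))
    (hs' : ∀ x, s' x • northPole n = x) (U' : Set (Sph n)) (hU' : IsOpen U')
    (hsU' : ContMDiffOn (𝓡 n) (soModel (n + 1)) ∞ s' U') :
    ContMDiffOn ((𝓡 n).prod I) ((𝓡 n).prod I) ∞
      (trivialization (α := α) s' hs' U' hU' hsU' ∘ (trivialization s hs U hU hsU).symm)
      ((trivialization (α := α) s hs U hU hsU).symm ≫ₕ
        trivialization s' hs' U' hU' hsU').source := by
  have h₁ : ContMDiffOn ((𝓡 n).prod I) ((soModel (n + 1)).prod I) ∞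
      (fun q : Sph n × G => (s q.1, q.2)) (U ×ˢ Set.univ) :=
    (hsU.comp contMDiffOn_fst fun q hq => hq.1).prodMk contMDiffOn_snd
  have h₂ : ContMDiffOn ((soModel (n + 1)).prod I) ((𝓡 n).prod I) ∞ (fun p : SO (n + 1) × G =>
      (p.1 • northPole n, fiberCoord s' hs' (BorelQuotient.mk α p.1 p.2)))
      {p | p.1 • northPole n ∈ U'} := fun p hp =>
    (contMDiffAt_prod_fiberCoord_mk s' hs' hU' hsU' hp).contMDiffWithinAt
  exact h₂.comp (h₁.mono fun q hq => hq.1) fun q hq => hq.2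

end Trivialization

/-! ### The Borel quotient as a smooth equivariant bundle. -/

variable [LieGroup I ∞ G] [NeZero n]

/-- A section of `SO(n+1) → S^n` which is smooth near `x`. -/
noncomputable def sectionAt (x : Sph n) : Sph n → SO (n + 1) :=
  (SO.exists_section NeZero.one_le x).choose

/-- An open neighbourhood of `x` on which `sectionAt x` is smooth. -/
noncomputable def sectionDomain (x : Sph n) : Set (Sph n) :=
  (SO.exists_section NeZero.one_le x).choose_spec.choose

theorem isOpen_sectionDomain (x : Sph n) : IsOpen (sectionDomain x) :=
  (SO.exists_section NeZero.one_le x).choose_spec.choose_spec.1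

theorem mem_sectionDomain (x : Sph n) : x ∈ sectionDomain x :=
  (SO.exists_section NeZero.one_le x).choose_spec.choose_spec.2.1

theorem contMDiffOn_sectionAt (x : Sph n) :
    ContMDiffOn (𝓡 n) (soModel (n + 1)) ∞ (sectionAt x) (sectionDomain x) :=
  (SO.exists_section NeZero.one_le x).choose_spec.choose_spec.2.2.1

theorem sectionAt_smul (x y : Sph n) : sectionAt x y • northPole n = y :=
  (SO.exists_section NeZero.one_le x).choose_spec.choose_spec.2.2.2 y

/-- A trivialization around a given point. -/
noncomputable def trivializationAt (z : BorelQuotient α) :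
    OpenPartialHomeomorph (BorelQuotient α) (Sph n × G) :=
  trivialization (sectionAt z.proj) (sectionAt_smul z.proj) (sectionDomain z.proj)
    (isOpen_sectionDomain z.proj) (contMDiffOn_sectionAt z.proj)

theorem mem_trivializationAt_source (z : BorelQuotient α) : z ∈ (trivializationAt z).source :=
  mem_sectionDomain z.proj

theorem contMDiffOn_trivializationAt_comp_symm (z w : BorelQuotient α) :
    ContMDiffOn ((𝓡 n).prod I) ((𝓡 n).prod I) ∞ (trivializationAt w ∘ (trivializationAt z).symm)
      ((trivializationAt z).symm ≫ₕ trivializationAt w).source :=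
  contMDiffOn_trivialization_comp_symm _ _ _ _ _ _ _ _ _ _

noncomputable instance :
    ChartedSpace (ModelProd (EuclideanSpace ℝ (Fin n)) HG) (BorelQuotient α) :=
  chartedSpaceOfLocalHomeomorph trivializationAt mem_trivializationAt_source

instance : IsManifold ((𝓡 n).prod I) ∞ (BorelQuotient α) :=
  isManifold_of_localHomeomorph _ trivializationAt mem_trivializationAt_source
    contMDiffOn_trivializationAt_comp_symm

theorem contMDiffOn_trivializationAt (z : BorelQuotient α) :
    ContMDiffOn ((𝓡 n).prod I) ((𝓡 n).prod I) ∞ (trivializationAt z)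
      (trivializationAt z).source :=
  contMDiffOn_localHomeomorph _ trivializationAt mem_trivializationAt_source
    contMDiffOn_trivializationAt_comp_symm z

theorem contMDiffOn_trivializationAt_symm (z : BorelQuotient α) :
    ContMDiffOn ((𝓡 n).prod I) ((𝓡 n).prod I) ∞ (trivializationAt z).symm
      (trivializationAt z).target :=
  contMDiffOn_localHomeomorph_symm _ trivializationAt mem_trivializationAt_source
    contMDiffOn_trivializationAt_comp_symm z

/-- The quotient map `SO(n+1) × G → SO(n+1) ×_{SO(n)} G` is smooth. -/
theorem contMDiff_mk : ContMDiff ((soModel (n + 1)).prod I) ((𝓡 n).prod I) ∞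
    (fun p : SO (n + 1) × G => BorelQuotient.mk α p.1 p.2) := by
  intro p
  set z := BorelQuotient.mk α p.1 p.2
  have h₂ : ContMDiffAt ((soModel (n + 1)).prod I) ((𝓡 n).prod I) ∞
      (fun p : SO (n + 1) × G => trivializationAt z (BorelQuotient.mk α p.1 p.2)) p :=
    contMDiffAt_prod_fiberCoord_mk _ (sectionAt_smul z.proj) (isOpen_sectionDomain z.proj)
      (contMDiffOn_sectionAt z.proj) (mem_sectionDomain z.proj)
  have h₃ := (contMDiffOn_trivializationAt_symm z).contMDiffAt
    ((trivializationAt z).open_target.mem_nhds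
      ((trivializationAt z).map_source (mem_trivializationAt_source z)))
  refine (ContMDiffAt.comp p h₃ h₂).congr_of_eventuallyEq ?_
  filter_upwards [isQuotientMap_mk.continuous.continuousAt.preimage_mem_nhds
    ((trivializationAt z).open_source.mem_nhds (mem_trivializationAt_source z))] with q hq
  exact ((trivializationAt z).left_inv hq).symm

/-- The quotient map `SO(n+1) × G → SO(n+1) ×_{SO(n)} G` has smooth local sections. -/
theorem exists_contMDiffAt_lift (z : BorelQuotient α) :
    ∃ σ : BorelQuotient α → SO (n + 1) × G,
      ContMDiffAt ((𝓡 n).prod I) ((soModel (n + 1)).prod I) ∞ σ z ∧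
      ∀ y, BorelQuotient.mk α (σ y).1 (σ y).2 = y := by
  have h₁ := (contMDiffOn_trivializationAt z).contMDiffAt
    ((trivializationAt z).open_source.mem_nhds (mem_trivializationAt_source z))
  have h₂ := (contMDiffOn_sectionAt z.proj).contMDiffAt
    ((isOpen_sectionDomain z.proj).mem_nhds (mem_sectionDomain z.proj))
  exact ⟨fun y => (sectionAt z.proj y.proj, fiberCoord _ (sectionAt_smul z.proj) y),
    (ContMDiffAt.comp z (g := sectionAt z.proj) (f := BorelQuotient.proj) h₂
      (contMDiffAt_fst.comp z h₁)).prodMk (contMDiffAt_snd.comp z h₁),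
    fun y => mk_fiberCoord _ (sectionAt_smul z.proj) y⟩

variable (α) in
/-- The `SO(n+1)`-equivariant bundle obtained by the Borel construction. -/
noncomputable def fullBundle : FullBundle I G n where
  Total := BorelQuotient α
  proj := BorelQuotient.proj
  contMDiff_proj z := contMDiffAt_fst.comp z ((contMDiffOn_trivializationAt z).contMDiffAt
    ((trivializationAt z).open_source.mem_nhds (mem_trivializationAt_source z)))
  rsmul := BorelQuotient.rsmul
  rsmul_one z := by
    obtain ⟨B, g, rfl⟩ := z.mk_surjective
    rw [rsmul_mk, mul_one]
  rsmul_mul z g h := by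
    obtain ⟨B, k, rfl⟩ := z.mk_surjective
    rw [rsmul_mk, rsmul_mk, rsmul_mk, mul_assoc]
  contMDiff_rsmul := by
    rintro ⟨z, g⟩
    -- A smooth local lift to `SO(n+1) × G` reduces smoothness of the action to that of
    -- multiplication in `G` and of the quotient map.
    obtain ⟨σ, hσ, hσ'⟩ := z.exists_contMDiffAt_lift
    have h₁ : ContMDiffAt (((𝓡 n).prod I).prod I) ((soModel (n + 1)).prod I) ∞
        (fun p : BorelQuotient α × G => σ p.1) (z, g) :=
      ContMDiffAt.comp (z, g) (g := σ) (f := Prod.fst) hσ contMDiffAt_fst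
    have h₂ : ContMDiffAt (((𝓡 n).prod I).prod I) ((soModel (n + 1)).prod I) ∞
        (fun p : BorelQuotient α × G => ((σ p.1).1, (σ p.1).2 * p.2)) (z, g) :=
      (contMDiffAt_fst.comp _ h₁).prodMk ((contMDiffAt_snd.comp _ h₁).mul contMDiffAt_snd)
    refine (ContMDiffAt.comp (z, g) (contMDiff_mk (α := α) _) h₂).congr_of_eventuallyEq
      (Filter.Eventually.of_forall fun p => ?_)
    change p.1.rsmul p.2 = (BorelQuotient.mk α (σ p.1).1 (σ p.1).2).rsmul p.2
    rw [hσ']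
  free z g h := by
    have := congrArg (fiberCoord _ (sectionAt_smul z.proj)) h
    rw [fiberCoord_rsmul] at this
    exact mul_eq_left.1 this
  proj_rsmul := proj_rsmul
  locally_trivial x := by
    -- Trivializations are indexed by points of the total space, so some point over `x` is needed.
    set z := BorelQuotient.mk α (sectionAt x x) 1
    have hz : z.proj = x := sectionAt_smul x x
    exact ⟨sectionDomain z.proj, trivializationAt z, isOpen_sectionDomain _,
      hz ▸ mem_sectionDomain z.proj, rfl, rfl, contMDiffOn_trivializationAt z,
      contMDiffOn_trivializationAt_symm z, fun w _ => ⟨rfl, fun g => fiberCoord_rsmul _ (sectionAt_smul z.proj) w g⟩⟩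
  lsmul := BorelQuotient.lsmul
  lsmul_one z := by
    obtain ⟨B, g, rfl⟩ := z.mk_surjective
    rw [lsmul_mk, one_mul]
  lsmul_mul C D z := by
    obtain ⟨B, k, rfl⟩ := z.mk_surjective
    rw [lsmul_mk, lsmul_mk, lsmul_mk, mul_assoc]
  contMDiff_lsmul := by
    rintro ⟨C, z⟩
    obtain ⟨σ, hσ, hσ'⟩ := z.exists_contMDiffAt_lift
    have h₁ : ContMDiffAt ((soModel (n + 1)).prod ((𝓡 n).prod I)) ((soModel (n + 1)).prod I) ∞
        (fun p : SO (n + 1) × BorelQuotient α => σ p.2) (C, z) :=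
      ContMDiffAt.comp (C, z) (g := σ) (f := Prod.snd) hσ contMDiffAt_snd
    have h₂ : ContMDiffAt ((soModel (n + 1)).prod ((𝓡 n).prod I)) ((soModel (n + 1)).prod I) ∞
        (fun p : SO (n + 1) × BorelQuotient α => (p.1 * (σ p.2).1, (σ p.2).2)) (C, z) :=
      (contMDiffAt_fst.mul (contMDiffAt_fst.comp _ h₁)).prodMk (contMDiffAt_snd.comp _ h₁)
    refine (ContMDiffAt.comp (C, z) (contMDiff_mk (α := α) _) h₂).congr_of_eventuallyEq
      (Filter.Eventually.of_forall fun p => ?_)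
    change BorelQuotient.lsmul p.1 p.2 =
      BorelQuotient.lsmul p.1 (BorelQuotient.mk α (σ p.2).1 (σ p.2).2)
    rw [hσ']
  lsmul_rsmul C z g := by
    obtain ⟨B, k, rfl⟩ := z.mk_surjective
    rfl
  proj_lsmul C z := by
    obtain ⟨B, k, rfl⟩ := z.mk_surjective
    exact mul_smul C B _

variable (α) in
theorem isBorelConstruction_fullBundle : (fullBundle α).IsBorelConstruction α :=
  ⟨Homeomorph.refl _, contMDiff_mk, fun _ => rfl, fun _ _ => rfl, fun _ _ => rfl⟩

variable (α) in
-- At `[1, 1]`, over the north pole, `A · [1, 1] = [A, 1] = [1, α(A)]`, so the isotropy homomorphism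
-- there is `α` itself.
theorem J_restrict_fullBundle : (fullBundle α).restrict.J = (α.compDelta.toClass, α.toClass) := by
  have hb : (fullBundle α).restrict.proj (BorelQuotient.mk α 1 1) = northPole n :=
    one_smul _ (northPole n)
  rw [FullBundle.J_restrict NeZero.one_le (fullBundle α) (BorelQuotient.mk α 1 1) hb]
  have h : (fullBundle α).restrict.isotropyRep (BorelQuotient.mk α 1 1)
      ((fullBundle α).restrict.fixed_of_north _ hb) = α := by
    refine DFunLike.ext _ _ fun A => ?_
    apply (fullBundle α).rsmul_injective (BorelQuotient.mk α 1 1)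
    refine ((fullBundle α).restrict.isotropyRep_spec (BorelQuotient.mk α 1 1) _ A).symm.trans ?_
    change BorelQuotient.mk α (SO.incl n A * 1) 1 = BorelQuotient.mk α 1 (1 * α A)
    rw [mul_one, one_mul, ← one_mul (SO.incl n A), mk_mul_incl, mul_one]
  rw [h]

end BorelQuotient

/-! ### The main theorem. -/

theorem mainTheorem9 {EG : Type*} [NormedAddCommGroup EG] [NormedSpace ℝ EG]
    [FiniteDimensional ℝ EG] {HG : Type*} [TopologicalSpace HG] (I : ModelWithCorners ℝ EG HG)
    [I.Boundaryless] (G : Type*) [Group G] [TopologicalSpace G] [ChartedSpace HG G]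
    [LieGroup I ∞ G] (n : ℕ) (hn : 1 ≤ n) :
    (∀ ξ : NGBundleClass I G n, ξ.ComesFromFull →
      ∃ α : SOHom I G n, ξ.J = (α.toClass, α.compDelta.toClass)) ∧
    (∀ α : SOHom I G n,
      (∃! ξ : NGBundleClass I G n,
        ξ.ComesFromFull ∧ ξ.J = (α.toClass, α.compDelta.toClass)) ∧
      ∃ η : FullBundle I G n, η.IsBorelConstruction α.compDelta ∧
        η.restrict.toClass.J = (α.toClass, α.compDelta.toClass)) := by
  -- The smooth structure on the Borel quotient is an instance and takes `1 ≤ n` in this form.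
  have : NeZero n := ⟨by omega⟩
  refine ⟨?_, fun α => ?_⟩
  · rintro _ ⟨η, rfl⟩
    obtain ⟨b, hb⟩ := η.restrict.proj_surjective (northPole n)
    -- The theorem's `α` is the isotropy over the south pole, hence the composition with `δ` of the
    -- one over the north pole.
    refine ⟨(η.restrict.isotropyRep b (η.restrict.fixed_of_north b hb)).compDelta, ?_⟩
    rw [SOHom.compDelta_compDelta]
    exact η.J_restrict hn b hb
  · have hJ : (BorelQuotient.fullBundle α.compDelta).restrict.toClass.J =
        (α.toClass, α.compDelta.toClass) := by
      refine (BorelQuotient.J_restrict_fullBundle α.compDelta).trans ?_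
      rw [SOHom.compDelta_compDelta]
    refine ⟨⟨_, ⟨⟨_, rfl⟩, hJ⟩, ?_⟩, _, BorelQuotient.isBorelConstruction_fullBundle _, hJ⟩
    rintro _ ⟨⟨η, rfl⟩, hη⟩
    -- Only the north pole component of `J` is needed for uniqueness.
    exact Quotient.sound (η.restrict_iso_of_J_snd_eq hn _ (congrArg Prod.snd (hη.trans hJ.symm)))
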